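/- **Setting.** Let $\mathcal V=K_0(\mathrm{Var}_{\mathbb C})\otimes_{\mathbb Z[\mathbb L]}\mathbb Q(\mathbb L^{1/2})$, where $K_0(\mathrm{Var}_{\mathbb C})$ is the Grothendieck ring of complex algebraic varieties and $\mathbb L=[\mathbb A^1]$; write $q=\mathbb L$. Let $\Gamma$ be a lattice of rank $2$ with a skew-symmetric bilinear form $\langle\cdot,\cdot\rangle:\Gamma\times\Gamma\to\mathbb Z$ and a basis $(e_1,e_2)$ such that $\langle e_1,e_2\rangle>0$. Put $\Gamma_+=\mathbb N e_1+\mathbb N e_2$ and $\Gamma_+^*=\Gamma_+\setminus\{0\}$. For a map $m:\Gamma_+^*\to\mathbb N$ with finite support put $\|m\|=\sum_\alpha m(\alpha)\alpha\in\Gamma_+$ and $m!=\prod_\alpha m(\alpha)!$. A ray is a set $l=\mathbb R_{>0}\gamma\subset\Gamma\otimes\mathbb R$ with $\gamma\in\Gamma_+^*$; rays are ordered by their slope in the first quadrant, so that the ray of $e_1$ is the smallest and that of $e_2$ the largest. The quantum torus of a commutative monoid $M$ with a skew-symmetric biadditive form $\langle\cdot,\cdot\rangle$ consists of the formal series $\sum_{\alpha\in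 M}c_\alpha x^\alpha$, $c_\alpha\in\mathcal V$, with the multiplication $x^\alpha\circ x^\beta=q^{\frac12\langle\alpha,\beta\rangle}x^{\alpha+\beta}$. We use it for $M=\Gamma_+$ (the quantum torus of $\Gamma$), and for the monoid $M$ of maps $m:\Gamma_+^*\to\mathbb N$ with finite support, regarded as dimension vectors of the following quiver $\hat Q$: its set of vertices is $\Gamma_+^*$, and there are $\max(\langle\beta,\alpha\rangle,0)$ arrows from $\alpha$ to $\beta$. The form in the latter case is $\langle m,m'\rangle=r(m',m)-r(m,m')$, where $r(m,m')=\sum_{a:\alpha\to\beta}m(\alpha)m'(\beta)$, the sum being over the arrows of $\hat Q$. **Abelian quiver invariants.** Let $Z:\Gamma\to\mathbb C$ be a homomorphism with $Z(e_i)=-d_i+\sqrt{-1}\,r_i\in\{re^{i\pi\varphi}:r>0,\ 0<\varphi\le1\}$ for $i=1,2$. For $\alpha\in\Gamma_+^*$ with $Z(\alpha)=-d+\sqrt{-1}\,r$ put $\mu_Z(\alpha)=d/r\in\mathbb R\cup\{\infty\}$. Assume that $\mu_Z(e_1)<\mu_Z(e_2)$. For $m$ as above let $\hat Q(m)$ be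 the finite quiver with the vertices $\alpha_k$, $\alpha\in\Gamma_+^*$, $1\le k\le m(\alpha)$, with as many arrows from $\alpha_k$ to $\beta_{k'}$ as there are from $\alpha$ to $\beta$ in $\hat Q$, and with the stability function $Z(\alpha_k)=Z(\alpha)$. Let $R_Z(\hat Q(m))$ be the open subvariety of semistable points in the affine space of the representations of $\hat Q(m)$ which have dimension $1$ at every vertex (a representation $M$ is semistable if $\mu_Z(\underline{\dim}\,N)\le\mu_Z(\underline{\dim}\,M)$ for every nonzero subrepresentation $N$). Put $$f_+(m)=q^{\frac12(v-a)}\frac{[R_Z(\hat Q(m))]}{(q-1)^{v}}\in\mathcal V,$$ where $v$ and $a$ are the numbers of vertices and arrows of $\hat Q(m)$. The abelian quiver invariants $g(m)\in\mathcal V$, $m\ne0$, are defined by the equations, one for every ray $l$, in the quantum torus of $\hat Q$, $$1+\sum_{\|m\|\in l}f_+(m)\frac{x^m}{m!}=\exp\Bigg(\sum_{\|m\|\in l}\frac{g(m)}{q^{1/2}-q^{-1/2}}\frac{x^m}{m!}\Bigg).$$ **Theorem.** Let $(\bar b_\gamma)_{\gamma\in\Gamma_+^*}$ and $(\bar a_\gamma)_{\gamma\in\Gamma_+^*}$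 be two families of elements of $\mathcal V$. Then the Kontsevich–Soibelman wall-crossing formula $$\prod_l^{\curvearrowright}\exp\left(\frac{\sum_{\gamma\in l}\bar b_\gamma x^\gamma}{q^{1/2}-q^{-1/2}}\right)=\prod_l^{\curvearrowleft}\exp\left(\frac{\sum_{\gamma\in l}\bar a_\gamma x^\gamma}{q^{1/2}-q^{-1/2}}\right)$$ holds in the quantum torus of $\Gamma$ (the products are over all rays $l$; on the left in clockwise order, that is, of decreasing slope from left to right, and on the right in anticlockwise order, that is, of increasing slope) if and only if the modified Manschot–Pioline–Sen formula $$\bar b_\gamma=\sum_{\|m\|=\gamma}\frac{g(m)}{m!}\prod_{\alpha\in\Gamma_+^*}\bar a_\alpha^{\,m(\alpha)}$$ holds for all $\gamma\in\Gamma_+^*$, where the sum is over the maps $m:\Gamma_+^*\to\mathbb N$ with finite support and $\|m\|=\gamma$. -/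

import Mathlib

open CategoryTheory AlgebraicGeometry Polynomial
open scoped TensorProduct

/-! ### Motivic classes -/

/-- A complex algebraic variety: a reduced separated scheme of finite type over `ℂ`. -/
structure CVariety : Type 1 where
  X : Scheme.{0}
  str : X ⟶ Spec (CommRingCat.of ℂ)
  isReduced : IsReduced X
  isSeparated : IsSeparated str
  locallyOfFiniteType : LocallyOfFiniteType str
  quasiCompact : QuasiCompact str

/-- The relations of the Grothendieck ring of varieties. -/
inductive K0Rel : MvPolynomial CVariety ℤ → Prop
  /-- Isomorphic varieties have the same class. -/
  | iso (X Y : CVariety) (f : X.X ⟶ Y.X) (hf : IsIso f) (hstr : f ≫ Y.str = X.str) :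
      K0Rel (MvPolynomial.X X - MvPolynomial.X Y)
  /-- `[X] = [Z] + [U]` for a closed subvariety `Z` of `X` with open complement `U`. -/
  | scissor (X Z U : CVariety) (i : Z.X ⟶ X.X) (j : U.X ⟶ X.X)
      (hi : IsClosedImmersion i) (hj : IsOpenImmersion j)
      (histr : i ≫ X.str = Z.str) (hjstr : j ≫ X.str = U.str)
      (hcompl : Set.range j = (Set.range i)ᶜ) :
      K0Rel (MvPolynomial.X X - (MvPolynomial.X Z + MvPolynomial.X U))
  /-- `[X × Y] = [X] [Y]`. -/
  | prod (P X Y : CVariety) (p : P.X ⟶ X.X) (r : P.X ⟶ Y.X)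
      (h : IsPullback p r X.str Y.str) (hstr : p ≫ X.str = P.str) :
      K0Rel (MvPolynomial.X P - MvPolynomial.X X * MvPolynomial.X Y)
  /-- The class of the point is `1`. -/
  | point (X : CVariety) (h : IsIso X.str) : K0Rel (MvPolynomial.X X - 1)

/-- The Grothendieck ring `K₀(Var_ℂ)`, as the commutative ring generated by the classes of
varieties. (The last two families of relations say that the product of classes is induced by the
product of varieties, with unit the class of the point.) -/
def K0Var : Type 1 := MvPolynomial CVariety ℤ ⧸ Ideal.span {p | K0Rel p}

noncomputable instance : CommRing K0Var :=
  inferInstanceAs (CommRing (MvPolynomial CVariety ℤ ⧸ Ideal.span {p | K0Rel p}))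

/-- The class `[X]` of a variety. -/
noncomputable def K0Var.cls (X : CVariety) : K0Var :=
  Ideal.Quotient.mk (Ideal.span {p | K0Rel p}) (MvPolynomial.X X)

/-- Affine space over `ℂ` with coordinates indexed by `A`. -/
noncomputable abbrev affSch (A : Type) : Scheme.{0} :=
  Spec (CommRingCat.of (MvPolynomial A ℂ))

/-- The structure morphism of affine space. -/
noncomputable abbrev affStr (A : Type) : affSch A ⟶ Spec (CommRingCat.of ℂ) :=
  Spec.map (CommRingCat.ofHom (algebraMap ℂ (MvPolynomial A ℂ)))

instance affStr_locallyOfFiniteType (A : Type) [Finite A] : LocallyOfFiniteType (affStr A) := by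
  rw [HasRingHomProperty.Spec_iff (P := @LocallyOfFiniteType)]
  simp only [CommRingCat.hom_ofHom]
  rw [RingHom.finiteType_algebraMap]
  infer_instance

/-- An open subset of affine space, as a variety. -/
noncomputable def openVariety (A : Type) [Finite A] (U : (affSch A).Opens) : CVariety where
  X := U.toScheme
  str := U.ι ≫ affStr A
  isReduced := inferInstance
  isSeparated := inferInstance
  locallyOfFiniteType := inferInstance
  quasiCompact := inferInstance

/-- The Lefschetz motive `𝕃 = [𝔸¹]`. -/
noncomputable def lefschetz : K0Var := K0Var.cls (openVariety Unit ⊤)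

/-- The field `ℚ(𝕃^{1/2})` of rational functions in the variable `𝕃^{1/2}`. -/
def HalfField : Type := RatFunc ℚ

noncomputable instance : Field HalfField := inferInstanceAs (Field (RatFunc ℚ))

noncomputable instance : Algebra ℚ HalfField := inferInstanceAs (Algebra ℚ (RatFunc ℚ))

/-- The variable `𝕃^{1/2} = q^{1/2}`. -/
noncomputable def HalfField.t : HalfField := (RatFunc.X : RatFunc ℚ)

/-- `K₀(Var_ℂ)` is a `ℤ[𝕃]`-algebra. -/
noncomputable instance : Algebra ℤ[X] K0Var :=
  (Polynomial.eval₂RingHom (Int.castRingHom K0Var) lefschetz).toAlgebra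

/-- `ℚ(𝕃^{1/2})` is a `ℤ[𝕃]`-algebra. -/
noncomputable instance : Algebra ℤ[X] HalfField :=
  (Polynomial.eval₂RingHom (Int.castRingHom HalfField) (HalfField.t ^ 2)).toAlgebra

/-- The coefficient ring `𝒱 = K₀(Var_ℂ) ⊗_{ℤ[𝕃]} ℚ(𝕃^{1/2})`. -/
def MotV : Type 1 := HalfField ⊗[ℤ[X]] K0Var

noncomputable instance : CommRing MotV := inferInstanceAs (CommRing (HalfField ⊗[ℤ[X]] K0Var))

noncomputable instance : Algebra HalfField MotV :=
  inferInstanceAs (Algebra HalfField (HalfField ⊗[ℤ[X]] K0Var))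

noncomputable instance : Algebra ℚ MotV :=
  ((algebraMap HalfField MotV).comp (algebraMap ℚ HalfField)).toAlgebra

/-- The class of a variety in `𝒱`. -/
noncomputable def MotV.cls (X : CVariety) : MotV :=
  (1 : HalfField) ⊗ₜ[ℤ[X]] K0Var.cls X

/-- The virtual motive `q^{1/2} - q^{-1/2}` of the multiplicative group. -/
noncomputable def gmVir : HalfField := HalfField.t - HalfField.t⁻¹

theorem HalfField.t_ne_zero : HalfField.t ≠ 0 := RatFunc.X_ne_zero

/-- `q^{1/2}` as a unit of `𝒱`. -/
noncomputable def sqrtQ : MotVˣ :=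
  Units.map (algebraMap HalfField MotV).toMonoidHom
    (Units.mk0 HalfField.t HalfField.t_ne_zero)

/-! ### Quantum tori -/

/-- Formal series `∑ a_α x^α`, `α ∈ M`, with coefficients in `R`, multiplied by the rule
`x^α ∘ x^β = v^⟨α,β⟩ x^(α+β)`. Here `v` plays the role of `q^{1/2}`. -/
@[ext]
structure QTorus {M R : Type*} [AddCommMonoid M] [CommRing R]
    (v : Rˣ) (ω : M →+ M →+ ℤ) where
  coeff : M → R

namespace QTorus

section

variable {M R : Type*} [AddCommMonoid M] [Finset.HasAntidiagonal M] [DecidableEq M]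
  [CommRing R] {v : Rˣ} {ω : M →+ M →+ ℤ}

instance : Zero (QTorus v ω) := ⟨⟨0⟩⟩
instance : Add (QTorus v ω) := ⟨fun A B => ⟨A.coeff + B.coeff⟩⟩
instance : Neg (QTorus v ω) := ⟨fun A => ⟨-A.coeff⟩⟩
instance : One (QTorus v ω) := ⟨⟨fun γ => if γ = 0 then 1 else 0⟩⟩

instance : Mul (QTorus v ω) :=
  ⟨fun A B => ⟨fun γ => ∑ p ∈ Finset.HasAntidiagonal.antidiagonal γ,
    ((v ^ ω p.1 p.2 : Rˣ) : R) * (A.coeff p.1 * B.coeff p.2)⟩⟩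

@[simp] theorem coeff_zero (γ : M) : (0 : QTorus v ω).coeff γ = 0 := rfl
@[simp] theorem coeff_add (A B : QTorus v ω) (γ : M) :
    (A + B).coeff γ = A.coeff γ + B.coeff γ := rfl
@[simp] theorem coeff_neg (A : QTorus v ω) (γ : M) : (-A).coeff γ = -A.coeff γ := rfl
theorem coeff_one (γ : M) : (1 : QTorus v ω).coeff γ = if γ = 0 then 1 else 0 := rfl
theorem coeff_mul (A B : QTorus v ω) (γ : M) :
    (A * B).coeff γ = ∑ p ∈ Finset.HasAntidiagonal.antidiagonal γ,
      ((v ^ ω p.1 p.2 : Rˣ) : R) * (A.coeff p.1 * B.coeff p.2) := rfl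

protected theorem mul_assoc' (A B C : QTorus v ω) : A * B * C = A * (B * C) := by
  ext γ
  simp only [coeff_mul, Finset.sum_mul, Finset.mul_sum, Finset.sum_sigma']
  apply Finset.sum_nbij' (fun ⟨⟨_i, j⟩, ⟨k, l⟩⟩ => ⟨(k, l + j), (l, j)⟩)
    (fun ⟨⟨i, _j⟩, ⟨k, l⟩⟩ => ⟨(i + k, l), (i, k)⟩)
  · rintro ⟨⟨i, j⟩, ⟨k, l⟩⟩ h
    simp only [Finset.mem_sigma, Finset.HasAntidiagonal.mem_antidiagonal, and_true] at h ⊢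
    obtain ⟨h1, h2⟩ := h
    subst h2
    simpa [add_assoc] using h1
  · rintro ⟨⟨i, j⟩, ⟨k, l⟩⟩ h
    simp only [Finset.mem_sigma, Finset.HasAntidiagonal.mem_antidiagonal] at h ⊢
    obtain ⟨h1, h2⟩ := h
    subst h2
    simpa [add_assoc] using h1
  · rintro ⟨⟨i, j⟩, ⟨k, l⟩⟩ h
    simp only [Finset.mem_sigma, Finset.HasAntidiagonal.mem_antidiagonal] at h
    obtain ⟨h1, h2⟩ := h
    subst h2
    rfl
  · rintro ⟨⟨i, j⟩, ⟨k, l⟩⟩ h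
    simp only [Finset.mem_sigma, Finset.HasAntidiagonal.mem_antidiagonal] at h
    obtain ⟨h1, h2⟩ := h
    subst h2
    rfl
  · rintro ⟨⟨i, j⟩, ⟨k, l⟩⟩ h
    simp only [Finset.mem_sigma, Finset.HasAntidiagonal.mem_antidiagonal] at h
    obtain ⟨h1, h2⟩ := h
    subst h2
    simp only [map_add, AddMonoidHom.add_apply, zpow_add, Units.val_mul]
    ring

theorem sum_antidiagonal_zero_left (f : M → M → R) (hf : ∀ a b, a ≠ 0 → f a b = 0) (γ : M) :
    ∑ p ∈ Finset.HasAntidiagonal.antidiagonal γ, f p.1 p.2 = f 0 γ := by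
  rw [Finset.sum_eq_single (0, γ)]
  · rintro ⟨a, b⟩ h hne
    apply hf
    rintro rfl
    simp_all
  · simp

theorem sum_antidiagonal_zero_right (f : M → M → R) (hf : ∀ a b, b ≠ 0 → f a b = 0) (γ : M) :
    ∑ p ∈ Finset.HasAntidiagonal.antidiagonal γ, f p.1 p.2 = f γ 0 := by
  rw [Finset.sum_eq_single (γ, 0)]
  · rintro ⟨a, b⟩ h hne
    apply hf
    rintro rfl
    simp_all
  · simp

/-- The quantum torus is an associative ring with unit `x^0`. -/
instance : Ring (QTorus v ω) where
  add_assoc A B C := by ext; simp [add_assoc]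
  zero_add A := by ext; simp
  add_zero A := by ext; simp
  add_comm A B := by ext; simp [add_comm]
  neg_add_cancel A := by ext; simp
  nsmul := nsmulRec
  zsmul := zsmulRec
  left_distrib A B C := by ext; simp [coeff_mul, mul_add, Finset.sum_add_distrib]
  right_distrib A B C := by ext; simp [coeff_mul, mul_add, add_mul, Finset.sum_add_distrib]
  zero_mul A := by ext; simp [coeff_mul]
  mul_zero A := by ext; simp [coeff_mul]
  mul_assoc := QTorus.mul_assoc'
  one_mul A := by
    ext γ
    rw [coeff_mul, sum_antidiagonal_zero_left
      (fun a b => ((v ^ ω a b : Rˣ) : R) * ((1 : QTorus v ω).coeff a * A.coeff b))]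
    · simp [coeff_one]
    · intro a b ha; simp [coeff_one, ha]
  mul_one A := by
    ext γ
    rw [coeff_mul, sum_antidiagonal_zero_right
      (fun a b => ((v ^ ω a b : Rˣ) : R) * (A.coeff a * (1 : QTorus v ω).coeff b))]
    · simp [coeff_one]
    · intro a b ha; simp [coeff_one, ha]

/-- `exp A = ∑ Aⁿ/n!`, for a series `A` without constant term. (If `M` is a monoid of finitely
supported functions to `ℕ`, only finitely many `n` contribute to a given coefficient.) -/
noncomputable def exp [Algebra ℚ R] (A : QTorus v ω) : QTorus v ω :=
  ⟨fun γ => ∑ᶠ n : ℕ, ((n.factorial : ℚ)⁻¹) • (A ^ n).coeff γ⟩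

end

end QTorus

/-! ### Stability and abelian quiver representations -/

/-- The half plane `{r e^{iπφ} : r > 0, 0 < φ ≤ 1}`. -/
def HPlus (z : ℂ) : Prop := 0 < z.im ∨ (z.im = 0 ∧ z.re < 0)

/-- The slope `d / r` of `z = -d + i r`, equal to `∞` if `r = 0`. -/
noncomputable def zslope (z : ℂ) : WithTop ℝ :=
  if z.im = 0 then ⊤ else ((-z.re / z.im : ℝ) : WithTop ℝ)

/-- The arrows of the quiver with vertex set `W` that has `r i j` arrows from `i` to `j`. -/
abbrev QArrow {W : Type} (r : W → W → ℕ) : Type := Σ p : W × W, Fin (r p.1 p.2)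

/-- The abelian representation over the field `k` (the one-dimensional space `k` at every vertex,
and the arrow `a` acting by the scalar `c a`) is semistable for the stability function with value
`ζ i` at the vertex `i`: every nonzero subrepresentation `N` satisfies `μ(dim N) ≤ μ(dim M)`. -/
def IsSemistableRep {W : Type} [Fintype W] (r : W → W → ℕ) (ζ : W → ℂ)
    {k : Type} [Field k] (c : QArrow r → k) : Prop :=
  ∀ N : W → Submodule k k,
    (∀ a : QArrow r, ∀ x ∈ N a.1.1, c a * x ∈ N a.1.2) → (∃ i, N i ≠ ⊥) →
      zslope (∑ i, (Module.finrank k (N i) : ℂ) * ζ i) ≤ zslope (∑ i, ζ i)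

theorem IsSemistableRep.mono {W : Type} [Fintype W] {r : W → W → ℕ} {ζ : W → ℂ}
    {k k' : Type} [Field k] [Field k'] {c : QArrow r → k} {c' : QArrow r → k'}
    (hcc : ∀ a, c a ≠ 0 → c' a ≠ 0) (h : IsSemistableRep r ζ c) : IsSemistableRep r ζ c' := by
  classical
  intro N' hN' hne
  have hN := h (fun i => if N' i = ⊥ then ⊥ else ⊤) ?_ ?_
  · have key : ∀ i, Module.finrank k
        ((if N' i = ⊥ then ⊥ else ⊤ : Submodule k k)) = Module.finrank k' (N' i) := by
      intro i
      by_cases hi : N' i = ⊥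
      · rw [if_pos hi, hi, finrank_bot, finrank_bot]
      · rw [if_neg hi, (Ideal.eq_bot_or_top (N' i)).resolve_left hi, finrank_top, finrank_top,
          Module.finrank_self, Module.finrank_self]
    simpa only [key] using hN
  · intro a x hx
    by_cases hsrc : N' a.1.1 = ⊥
    · rw [if_pos hsrc, Submodule.mem_bot] at hx
      rw [hx, mul_zero]
      exact Submodule.zero_mem _
    · by_cases hca : c a = 0
      · rw [hca, zero_mul]
        exact Submodule.zero_mem _
      · have htop : N' a.1.1 = ⊤ := (Ideal.eq_bot_or_top (N' a.1.1)).resolve_left hsrc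
        have h1 := hN' a 1 (by rw [htop]; exact Submodule.mem_top)
        have htgt : N' a.1.2 ≠ ⊥ := by
          intro hb
          rw [hb, mul_one, Submodule.mem_bot] at h1
          exact hcc a hca h1
        rw [if_neg htgt]
        exact Submodule.mem_top
  · obtain ⟨i, hi⟩ := hne
    refine ⟨i, ?_⟩
    rw [if_neg hi]
    exact top_ne_bot

/-- The representation at a point of the space `R(Q) = 𝔸^{Q₁}` of abelian representations: over the
residue field, the arrow `a` acts by the value of the `a`-th coordinate. -/
noncomputable def pointRep {A : Type} (p : PrimeSpectrum (MvPolynomial A ℂ)) (a : A) :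
    p.asIdeal.ResidueField :=
  algebraMap (MvPolynomial A ℂ) p.asIdeal.ResidueField (MvPolynomial.X a)

theorem pointRep_eq_zero {A : Type} (p : PrimeSpectrum (MvPolynomial A ℂ)) (a : A) :
    pointRep p a = 0 ↔ (MvPolynomial.X a : MvPolynomial A ℂ) ∈ p.asIdeal :=
  Ideal.algebraMap_residueField_eq_zero

theorem isOpen_semistable {W : Type} [Fintype W] (r : W → W → ℕ) (ζ : W → ℂ) :
    IsOpen {p : PrimeSpectrum (MvPolynomial (QArrow r) ℂ) |
      IsSemistableRep r ζ (pointRep p)} := by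
  classical
  rw [isOpen_iff_forall_mem_open]
  intro p hp
  let U : TopologicalSpace.Opens (PrimeSpectrum (MvPolynomial (QArrow r) ℂ)) :=
    PrimeSpectrum.basicOpen (∏ a : QArrow r,
      if (MvPolynomial.X a : MvPolynomial (QArrow r) ℂ) ∈ p.asIdeal then 1
      else MvPolynomial.X a)
  refine ⟨U, ?_, U.isOpen, ?_⟩
  · intro p' hp'
    refine IsSemistableRep.mono ?_ hp
    intro a ha h0
    rw [Ne, pointRep_eq_zero] at ha
    rw [pointRep_eq_zero] at h0
    refine hp' (Ideal.mem_of_dvd _ (Finset.dvd_prod_of_mem _ (Finset.mem_univ a)) ?_)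
    simpa [ha] using h0
  · intro hmem
    obtain ⟨a, -, ha⟩ := (Ideal.IsPrime.prod_mem_iff (hp := p.isPrime)).1 hmem
    by_cases h : (MvPolynomial.X a : MvPolynomial (QArrow r) ℂ) ∈ p.asIdeal
    · rw [if_pos h] at ha
      exact p.isPrime.ne_top ((Ideal.eq_top_iff_one _).2 ha)
    · rw [if_neg h] at ha
      exact h ha

/-- The open subset `R_Z(Q)` of semistable points of the space `R(Q) = 𝔸^{Q₁}` of abelian
representations of the finite quiver `Q`. -/
noncomputable def semistableLocus {W : Type} [Fintype W] (r : W → W → ℕ) (ζ : W → ℂ) :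
    (affSch (QArrow r)).Opens :=
  ⟨{p : PrimeSpectrum (MvPolynomial (QArrow r) ℂ) | IsSemistableRep r ζ (pointRep p)},
    isOpen_semistable r ζ⟩

/-- The motivic invariant `f_Z(Q) = q^{(|Q₀|-|Q₁|)/2} [R_Z(Q)] / (q-1)^{|Q₀|}` of the stack of
semistable abelian representations of a finite quiver `Q`. -/
noncomputable def fAbelian {W : Type} [Fintype W] (r : W → W → ℕ) (ζ : W → ℂ) : MotV :=
  (HalfField.t ^ ((Fintype.card W : ℤ) - (Fintype.card (QArrow r) : ℤ)) *
    ((HalfField.t ^ 2 - 1) ^ Fintype.card W)⁻¹) •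
  MotV.cls (openVariety (QArrow r) (semistableLocus r ζ))

/-- `f_Z(m) = f_Z(Q(m))` for a possibly infinite quiver `Q`, given by the numbers `r i j` of arrows
from `i` to `j`, a stability function with value `ζ i` at `i`, and a dimension vector `m`:
the quiver `Q(m)` has the vertices `i_k`, `1 ≤ k ≤ m i`, with `r i j` arrows from `i_k` to `j_k'`. -/
noncomputable def fDim {V : Type} (r : V → V → ℕ) (ζ : V → ℂ) (m : V →₀ ℕ) : MotV :=
  fAbelian (W := Σ i : m.support, Fin (m i)) (fun x y => r x.1 y.1) (fun x => ζ x.1)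

/-- The bilinear form `r(α,β) = ∑_{a : i → j} α_i β_j` on the dimension vectors of a quiver. -/
def quiverForm {V : Type} (r : V → V → ℕ) (α β : V →₀ ℕ) : ℕ :=
  α.sum fun i a => β.sum fun j b => a * b * r i j

theorem quiverForm_add_left {V : Type} (r : V → V → ℕ) (α α' β : V →₀ ℕ) :
    quiverForm r (α + α') β = quiverForm r α β + quiverForm r α' β := by
  classical
  unfold quiverForm
  refine Finsupp.sum_add_index' (fun i => by simp) (fun i a a' => ?_)
  rw [← Finsupp.sum_add]
  exact Finsupp.sum_congr fun j _ => by ring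

theorem quiverForm_add_right {V : Type} (r : V → V → ℕ) (α β β' : V →₀ ℕ) :
    quiverForm r α (β + β') = quiverForm r α β + quiverForm r α β' := by
  classical
  unfold quiverForm
  rw [← Finsupp.sum_add]
  refine Finsupp.sum_congr fun i _ => ?_
  exact Finsupp.sum_add_index' (by simp) (fun _ _ _ => by ring)

/-- The skew form `⟨α,β⟩ = r(β,α) - r(α,β)` on the dimension vectors of a quiver. -/
noncomputable def quiverSkew {V : Type} (r : V → V → ℕ) : (V →₀ ℕ) →+ (V →₀ ℕ) →+ ℤ where
  toFun α :=
    { toFun := fun β => (quiverForm r β α : ℤ) - (quiverForm r α β : ℤ)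
      map_zero' := by simp [quiverForm]
      map_add' := fun β β' => by
        rw [quiverForm_add_left, quiverForm_add_right]; push_cast; ring }
  map_zero' := AddMonoidHom.ext fun β => by simp [quiverForm]
  map_add' α α' := AddMonoidHom.ext fun β => by
    simp only [AddMonoidHom.coe_mk, ZeroHom.coe_mk, AddMonoidHom.add_apply]
    rw [quiverForm_add_left, quiverForm_add_right]; push_cast; ring

/-! ### The rank two lattice -/

/-- `Γ₊ = ℕ e₁ + ℕ e₂`, in coordinates. -/
abbrev GPlus : Type := Fin 2 →₀ ℕ

/-- `Γ₊^* = Γ₊ \ {0}`. -/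
abbrev GStar : Type := {γ : GPlus // γ ≠ 0}

/-- The inclusion of `Γ₊` in the lattice `Γ` with basis `e`. -/
noncomputable def toLattice {Γ : Type*} [AddCommGroup Γ] (e : Module.Basis (Fin 2) ℤ Γ) :
    GPlus →+ Γ where
  toFun γ := γ 0 • e 0 + γ 1 • e 1
  map_zero' := by simp
  map_add' γ δ := by simp only [Finsupp.add_apply, add_smul]; abel

/-- The restriction to `Γ₊` of a bilinear form on `Γ`. -/
noncomputable def formPlus {Γ : Type*} [AddCommGroup Γ] (e : Module.Basis (Fin 2) ℤ Γ)
    (ω : LinearMap.BilinForm ℤ Γ) : GPlus →+ GPlus →+ ℤ where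
  toFun γ :=
    { toFun := fun δ => ω (toLattice e γ) (toLattice e δ)
      map_zero' := by simp
      map_add' := fun δ δ' => by simp }
  map_zero' := by ext; simp
  map_add' γ γ' := by ext; simp

/-- A ray `l = ℝ_{>0} v` with `v ∈ Γ₊^*`, given by the unique indivisible `v ∈ l ∩ Γ₊`. -/
def Ray : Type := {v : GPlus // Nat.gcd (v 0) (v 1) = 1}

/-- `γ ∈ l`, for `γ ∈ Γ₊`. -/
def Ray.Mem (l : Ray) (γ : GPlus) : Prop := ∃ n : ℕ, 0 < n ∧ γ = n • l.1

/-- `l` has smaller slope than `l'` in the first quadrant: `l₁/l₀ < l'₁/l'₀`. -/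
def Ray.slopeLT (l l' : Ray) : Prop := l.1 1 * l'.1 0 < l'.1 1 * l.1 0

/-- `P` is the ordered product of the series `F l` over all rays `l`, where `before l l'` means that
the factor of `l` stands to the left of the factor of `l'`: each coefficient of `P` is the
corresponding coefficient of the product over all sufficiently large finite sets of rays. -/
def HasOrderedProd {ω : GPlus →+ GPlus →+ ℤ} (before : Ray → Ray → Prop)
    (F : Ray → QTorus sqrtQ ω) (P : QTorus sqrtQ ω) : Prop :=
  ∀ γ : GPlus, ∃ S : Finset Ray, ∀ L : List Ray, L.Pairwise before → (∀ l ∈ S, l ∈ L) →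
    (L.map F).prod.coeff γ = P.coeff γ

open Classical in
/-- The factor `exp (∑_{γ ∈ l} a_γ x^γ / (q^{1/2} - q^{-1/2}))` of the ray `l`. -/
noncomputable def rayExp (ω : GPlus →+ GPlus →+ ℤ) (a : GStar → MotV) (l : Ray) :
    QTorus sqrtQ ω :=
  QTorus.exp ⟨fun γ => if h : γ ≠ 0 ∧ l.Mem γ then gmVir⁻¹ • a ⟨γ, h.1⟩ else 0⟩

/-- The Kontsevich–Soibelman wall-crossing formula: the product of the factors of `b` over the rays
in clockwise order (of decreasing slope) is equal to the product of the factors of `a` over the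
rays in anticlockwise order (of increasing slope). -/
def KSFormula (ω : GPlus →+ GPlus →+ ℤ) (b a : GStar → MotV) : Prop :=
  ∃ P : QTorus sqrtQ ω,
    HasOrderedProd (fun l l' => l'.slopeLT l) (rayExp ω b) P ∧
    HasOrderedProd (fun l l' => l.slopeLT l') (rayExp ω a) P

/-- `‖m‖ = ∑ m(α) α` for `m : Γ₊^* → ℕ` of finite support. -/
noncomputable def mnorm (m : GStar →₀ ℕ) : GPlus := m.sum fun α k => k • α.1

/-- `m! = ∏ m(α)!`. -/
noncomputable def mfact (m : GStar →₀ ℕ) : ℕ := m.prod fun _ k => k.factorial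

/-- The quiver `Q̂` on the vertex set `Γ₊^*`, with `⟨β,α⟩` arrows from `α` to `β` if this number is
positive, and no arrow otherwise. -/
noncomputable def hatQuiver (ω : GPlus →+ GPlus →+ ℤ) (α β : GStar) : ℕ := (ω β.1 α.1).toNat

open Classical in
/-- `g` is the family of abelian quiver invariants of `Q̂` with the stability function induced by
`Z`: for every ray `l`, in the quantum torus of `Q̂`,
`1 + ∑_{‖m‖ ∈ l} f_Z(m) x^m / m! = exp (∑_{‖m‖ ∈ l} g(m) / (q^{1/2} - q^{-1/2}) x^m / m!)`. -/
def IsAbelianInvariants (ω : GPlus →+ GPlus →+ ℤ) (Z : GPlus →+ ℂ)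
    (g : (GStar →₀ ℕ) → MotV) : Prop :=
  ∀ l : Ray,
    (1 + ⟨fun m => if l.Mem (mnorm m) then
        ((mfact m : ℚ)⁻¹) • fDim (hatQuiver ω) (fun α => Z α.1) m else 0⟩ :
      QTorus sqrtQ (quiverSkew (hatQuiver ω))) =
    QTorus.exp ⟨fun m => if l.Mem (mnorm m) then
        ((mfact m : ℚ)⁻¹) • (gmVir⁻¹ • g m) else 0⟩

/-- The modified Manschot–Pioline–Sen formula
`b_γ = ∑_{‖m‖ = γ} g(m)/m! ∏ a_α^{m(α)}` (a finite sum) for all `γ ∈ Γ₊^*`. -/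
def MPSFormula (g : (GStar →₀ ℕ) → MotV) (b a : GStar → MotV) : Prop :=
  ∀ γ : GStar, b γ = ∑ᶠ m ∈ {m : GStar →₀ ℕ | mnorm m = γ.1},
    ((mfact m : ℚ)⁻¹) • (g m * m.prod fun α k => a α ^ k)

/-!
An abelian representation of a quiver is determined, up to the size of its nonzero entries, by the
set of its nonzero arrows, and its semistability only depends on the sets of vertices closed under
these arrows. Hence `f₊(m)` is a normalised weighted count of relations, and the Harder–Narasimhan
recursion for relations factorises, in the quantum torus of `Q̂`, the series of all abelian
representations into series of semistable ones, in the order of decreasing slope for the stability.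

For the stability induced by `Z` the factors are, by definition, the exponentials of the series of
the `g(m)`, and the product is clockwise. For the opposite stability every arrow of `Q̂` is
destabilising, so that a semistable representation lives on the vertices of one ray, which are not
joined by arrows; the factors are then the exponentials of `∑ x_α / (q^{1/2} - q^{-1/2})`, and the
product is anticlockwise.

The substitution `x^m ↦ ∏ a_α^{m(α)} x^{‖m‖}` turns these into two factorisations of one series in
the quantum torus of `Γ`: anticlockwise with the family `a`, and clockwise with the right hand
sides of the Manschot–Pioline–Sen formula. Since the clockwise factorisation of a series is unique,
the wall-crossing formula holds exactly if the family `b` is given by these right hand sides.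
-/

open Finset.HasAntidiagonal (antidiagonal mem_antidiagonal)

/-! ### Classes of coordinatewise defined open subsets of affine space -/

namespace K0Var

theorem mk_eq_mk {p q : MvPolynomial CVariety ℤ} (h : K0Rel (p - q)) :
    Ideal.Quotient.mk (Ideal.span {p | K0Rel p}) p = Ideal.Quotient.mk _ q :=
  (Ideal.Quotient.mk_eq_mk_iff_sub_mem _ _).2 (Ideal.subset_span h)

theorem cls_iso (X Y : CVariety) (f : X.X ⟶ Y.X) (hf : IsIso f) (hstr : f ≫ Y.str = X.str) :
    cls X = cls Y :=
  mk_eq_mk (.iso X Y f hf hstr)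

theorem cls_scissor (X Z U : CVariety) (i : Z.X ⟶ X.X) (j : U.X ⟶ X.X)
    (hi : IsClosedImmersion i) (hj : IsOpenImmersion j)
    (histr : i ≫ X.str = Z.str) (hjstr : j ≫ X.str = U.str)
    (hcompl : Set.range j = (Set.range i)ᶜ) : cls X = cls Z + cls U :=
  mk_eq_mk (.scissor X Z U i j hi hj histr hjstr hcompl)

theorem cls_prod (P X Y : CVariety) (p : P.X ⟶ X.X) (r : P.X ⟶ Y.X)
    (h : IsPullback p r X.str Y.str) (hstr : p ≫ X.str = P.str) : cls P = cls X * cls Y :=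
  mk_eq_mk (.prod P X Y p r h hstr)

theorem cls_point (X : CVariety) (h : IsIso X.str) : cls X = 1 :=
  mk_eq_mk (.point X h)

/-- The canonical ring homomorphism `K₀(Var_ℂ) → 𝒱`. -/
noncomputable def toMotV : K0Var →+* MotV :=
  (Algebra.TensorProduct.includeRight : K0Var →ₐ[ℤ[X]] HalfField ⊗[ℤ[X]] K0Var).toRingHom

theorem toMotV_cls (X : CVariety) : toMotV (cls X) = MotV.cls X := rfl

theorem toMotV_lefschetz : toMotV lefschetz = algebraMap HalfField MotV (HalfField.t ^ 2) := by
  have h1 : algebraMap ℤ[X] K0Var X = lefschetz := Polynomial.eval₂_X _ _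
  have h2 : algebraMap ℤ[X] HalfField X = HalfField.t ^ 2 := Polynomial.eval₂_X _ _
  rw [← h1, ← h2]
  exact (Algebra.TensorProduct.includeRight :
    K0Var →ₐ[ℤ[X]] HalfField ⊗[ℤ[X]] K0Var).commutes X

end K0Var

/-- The morphism of affine spaces `𝔸^A → 𝔸^B` with coordinates `f b`, `b ∈ B`. -/
noncomputable abbrev affMap {A B : Type} (f : B → MvPolynomial A ℂ) : affSch A ⟶ affSch B :=
  Spec.map (CommRingCat.ofHom (MvPolynomial.aeval f).toRingHom)

theorem affMap_str {A B : Type} (f : B → MvPolynomial A ℂ) : affMap f ≫ affStr B = affStr A := by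
  rw [← Spec.map_comp, ← CommRingCat.ofHom_comp]
  congr 2
  exact (MvPolynomial.aeval f).comp_algebraMap

theorem affMap_comp {A B C : Type} (f : B → MvPolynomial A ℂ) (g : C → MvPolynomial B ℂ) :
    affMap f ≫ affMap g = affMap fun c => MvPolynomial.aeval f (g c) := by
  rw [← Spec.map_comp, ← CommRingCat.ofHom_comp]
  congr 2
  exact congrArg AlgHom.toRingHom (MvPolynomial.comp_aeval g (MvPolynomial.aeval f))

theorem affMap_X (A : Type) :
    affMap (fun a : A => (MvPolynomial.X a : MvPolynomial A ℂ)) = 𝟙 (affSch A) := by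
  rw [← Spec.map_id, ← CommRingCat.ofHom_id, affMap, MvPolynomial.aeval_X_left]
  rfl

theorem isIso_affMap {A B : Type} (e : A ≃ B) :
    IsIso (affMap fun b : B => (MvPolynomial.X (e.symm b) : MvPolynomial A ℂ)) := by
  refine ⟨affMap fun a : A => MvPolynomial.X (e a), ?_, ?_⟩
  · simp only [affMap_comp, MvPolynomial.aeval_X, Equiv.symm_apply_apply, affMap_X]
  · simp only [affMap_comp, MvPolynomial.aeval_X, Equiv.apply_symm_apply, affMap_X]

theorem morphismRestrict_affMap_str {A B : Type} [Finite A] [Finite B]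
    (f : B → MvPolynomial A ℂ) (U : (affSch B).Opens) :
    (affMap f ∣_ U) ≫ (openVariety B U).str = (openVariety A (affMap f ⁻¹ᵁ U)).str := by
  simp only [openVariety]
  rw [← Category.assoc, morphismRestrict_ι, Category.assoc, affMap_str]

theorem cls_openVariety_equiv {A B : Type} [Finite A] [Finite B] (e : A ≃ B)
    (U : (affSch B).Opens) :
    K0Var.cls (openVariety A
      (affMap (fun b : B => (MvPolynomial.X (e.symm b) : MvPolynomial A ℂ)) ⁻¹ᵁ U)) =
      K0Var.cls (openVariety B U) := by
  have := isIso_affMap e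
  exact K0Var.cls_iso _ _ (affMap (fun b => .X (e.symm b)) ∣_ U)
    (inferInstanceAs (IsIso (_ ∣_ U))) (morphismRestrict_affMap_str _ _)

theorem cls_openVariety_bot (A : Type) [Finite A] : K0Var.cls (openVariety A ⊥) = 0 := by
  have : K0Var.cls (openVariety A ⊥) =
      K0Var.cls (openVariety A ⊥) + K0Var.cls (openVariety A ⊥) := by
    refine K0Var.cls_scissor _ _ _ (𝟙 _) (𝟙 _) inferInstance inferInstance
      (Category.id_comp _) (Category.id_comp _) ?_
    ext x
    exact x.2.elim
  simpa using this

theorem cls_openVariety_top_of_isEmpty (A : Type) [IsEmpty A] :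
    K0Var.cls (openVariety A ⊤) = 1 := by
  apply K0Var.cls_point
  have : IsIso (CommRingCat.ofHom (algebraMap ℂ (MvPolynomial A ℂ))) := by
    rw [ConcreteCategory.isIso_iff_bijective]
    exact (MvPolynomial.isEmptyAlgEquiv ℂ A).symm.bijective
  have : IsIso (⊤ : (affSch A).Opens).ι := inferInstanceAs (IsIso (Scheme.topIso _).hom)
  exact inferInstanceAs (IsIso ((⊤ : (affSch A).Opens).ι ≫ affStr A))

/-- The projection `𝔸^(Option A) → 𝔸^A` that forgets the coordinate `none`. -/
noncomputable abbrev affProj (A : Type) : affSch (Option A) ⟶ affSch A :=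
  affMap (fun a => MvPolynomial.X (some a))

/-- The section of `affProj A` with coordinate `none` equal to `0`. -/
noncomputable abbrev affZero (A : Type) : affSch A ⟶ affSch (Option A) :=
  affMap (fun o => o.elim 0 MvPolynomial.X)

/-- The section of `affProj A` with coordinate `none` equal to `1`. -/
noncomputable abbrev affOne (A : Type) : affSch A ⟶ affSch (Option A) :=
  affMap (fun o => o.elim 1 MvPolynomial.X)

/-- The locus in affine space where the coordinate `a` does not vanish. -/
noncomputable def coordOpen {A : Type} (a : A) : (affSch A).Opens :=
  PrimeSpectrum.basicOpen (MvPolynomial.X a : MvPolynomial A ℂ)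

theorem aeval_elim_zero_rename_some {A : Type} (p : MvPolynomial A ℂ) :
    MvPolynomial.aeval (fun o : Option A => (o.elim 0 .X : MvPolynomial A ℂ))
      (MvPolynomial.rename some p) = p := by
  rw [MvPolynomial.aeval_rename]
  exact MvPolynomial.aeval_X_left_apply p

theorem aeval_elim_zero_surjective (A : Type) : Function.Surjective
    (MvPolynomial.aeval (R := ℂ)
      (fun o : Option A => (o.elim 0 .X : MvPolynomial A ℂ))).toRingHom :=
  fun p => ⟨_, aeval_elim_zero_rename_some p⟩

theorem sub_rename_aeval_elim_zero_mem_span {A : Type} (f : MvPolynomial (Option A) ℂ) :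
    f - MvPolynomial.rename some
        (MvPolynomial.aeval (fun o : Option A => (o.elim 0 .X : MvPolynomial A ℂ)) f) ∈
      Ideal.span {(MvPolynomial.X none : MvPolynomial (Option A) ℂ)} := by
  rw [← Ideal.Quotient.mk_eq_mk_iff_sub_mem]
  let φ : MvPolynomial (Option A) ℂ →ₐ[ℂ] _ := Ideal.Quotient.mkₐ ℂ
    (Ideal.span {(MvPolynomial.X none : MvPolynomial (Option A) ℂ)})
  suffices φ = (φ.comp (MvPolynomial.rename some)).comp (MvPolynomial.aeval
    (fun o : Option A => (o.elim 0 .X : MvPolynomial A ℂ))) from DFunLike.congr_fun this f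
  apply MvPolynomial.algHom_ext
  rintro (_ | a) <;> simp [φ]

instance (A : Type) : IsClosedImmersion (affZero A) :=
  IsClosedImmersion.spec_of_surjective _ (aeval_elim_zero_surjective A)

theorem mem_range_affZero {A : Type} (p : PrimeSpectrum (MvPolynomial (Option A) ℂ)) :
    p ∈ Set.range (affZero A) ↔ (MvPolynomial.X none : MvPolynomial (Option A) ℂ) ∈ p.asIdeal := by
  change p ∈ Set.range (PrimeSpectrum.comap _) ↔ _
  rw [CommRingCat.hom_ofHom, range_comap_of_surjective _ _ (aeval_elim_zero_surjective A),
    PrimeSpectrum.mem_zeroLocus]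
  refine ⟨fun h => h (by simp [RingHom.mem_ker]), fun h f hf => ?_⟩
  replace hf : MvPolynomial.aeval
    (fun o : Option A => (o.elim 0 .X : MvPolynomial A ℂ)) f = 0 := hf
  have hspan := sub_rename_aeval_elim_zero_mem_span f
  rw [hf, map_zero, sub_zero] at hspan
  exact (Ideal.span_singleton_le_iff_mem _).2 h hspan

theorem range_homOfLE_coordOpen {A : Type} (U : (affSch (Option A)).Opens) :
    Set.range ((affSch (Option A)).homOfLE (inf_le_left : U ⊓ coordOpen none ≤ U)) =
      (Set.range (affZero A ∣_ U))ᶜ := by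
  ext ⟨x, hxU⟩
  have hx : (⟨x, hxU⟩ : U) ∈ Set.range (affZero A ∣_ U) ↔ x ∈ Set.range (affZero A) := by
    constructor
    · rintro ⟨y, hy⟩
      exact ⟨y.1, by rw [← morphismRestrict_base_coe, hy]⟩
    · rintro ⟨y, rfl⟩
      exact ⟨⟨y, hxU⟩, Subtype.ext (morphismRestrict_base_coe _ _ _)⟩
  refine Iff.trans ?_ (not_congr (hx.trans (mem_range_affZero x))).symm
  constructor
  · rintro ⟨y, hy⟩
    have hxy : y.1 = x := (Scheme.homOfLE_apply _ _).symm.trans (congrArg Subtype.val hy)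
    exact (hxy ▸ y.2 : x ∈ U ⊓ coordOpen none).2
  · intro h
    exact ⟨⟨x, hxU, h⟩, Scheme.homOfLE_apply' _ _ _⟩

theorem cls_openVariety_option (A : Type) [Finite A] (U : (affSch (Option A)).Opens) :
    K0Var.cls (openVariety (Option A) U) =
      K0Var.cls (openVariety A (affZero A ⁻¹ᵁ U)) +
        K0Var.cls (openVariety (Option A) (U ⊓ coordOpen none)) := by
  refine K0Var.cls_scissor _ _ _ (affZero A ∣_ U) (Scheme.homOfLE _ inf_le_left) ?_ ?_ ?_ ?_ ?_
  · exact MorphismProperty.of_isPullback (P := @IsClosedImmersion)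
      (isPullback_morphismRestrict (affZero A) U).flip inferInstance
  · exact inferInstanceAs (IsOpenImmersion (Scheme.homOfLE _ inf_le_left))
  · exact morphismRestrict_affMap_str _ _
  · simp [openVariety]
  · exact range_homOfLE_coordOpen U

theorem isPullback_affProj (A : Type) :
    IsPullback (affProj A) (affMap fun _ : Unit => MvPolynomial.X (none : Option A))
      (affStr A) (affStr Unit) := by
  apply isPullback_SpecMap_of_isPushout
  refine ⟨⟨?_⟩, ⟨Limits.PushoutCocone.IsColimit.mk _ (fun s => CommRingCat.ofHom
    (MvPolynomial.eval₂Hom (s.inl.hom.comp (algebraMap ℂ (MvPolynomial A ℂ)))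
      (fun o => o.elim (s.inr.hom (MvPolynomial.X ())) fun a => s.inl.hom (MvPolynomial.X a))))
      ?_ ?_ ?_⟩⟩
  · ext x
    simp
  · intro s
    ext x <;> simp
  · intro s
    have hs := congrArg CommRingCat.Hom.hom s.condition
    ext x
    · simpa using congrArg (fun f => f x) hs
    · simp
  · intro s m h1 h2
    ext x
    · simpa using congrArg (fun f => f.hom (MvPolynomial.C x)) h1
    · rcases x with _ | a
      · simpa using congrArg (fun f => f.hom (MvPolynomial.X ())) h2
      · simpa using congrArg (fun f => f.hom (MvPolynomial.X a)) h1

theorem cls_preimage_affProj (A : Type) [Finite A] (V : (affSch A).Opens) :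
    K0Var.cls (openVariety (Option A) (affProj A ⁻¹ᵁ V)) =
      K0Var.cls (openVariety A V) * lefschetz := by
  let e : (⊤ : (affSch Unit).Opens).toScheme ≅ affSch Unit := Scheme.topIso _
  refine K0Var.cls_prod _ _ _ (affProj A ∣_ V)
    ((affProj A ⁻¹ᵁ V).ι ≫ (affMap fun _ : Unit => MvPolynomial.X (none : Option A)) ≫
      e.inv) ?_ (morphismRestrict_affMap_str _ _)
  refine ((isPullback_morphismRestrict (affProj A) V).paste_vert (isPullback_affProj A)).of_iso
    (Iso.refl _) (Iso.refl _) e.symm (Iso.refl _) ?_ ?_ ?_ ?_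
  all_goals simp [openVariety, e]

theorem affZero_preimage_affProj {A : Type} (V : (affSch A).Opens) :
    affZero A ⁻¹ᵁ (affProj A ⁻¹ᵁ V) = V := by
  rw [← Scheme.Hom.comp_preimage, affMap_comp]
  simp only [MvPolynomial.aeval_X, Option.elim_some]
  rw [affMap_X, Scheme.Hom.id_preimage]

theorem cls_openVariety_slice (A : Type) [Finite A] (U : (affSch (Option A)).Opens)
    (V : (affSch A).Opens) (hV : U ⊓ coordOpen none = (affProj A ⁻¹ᵁ V) ⊓ coordOpen none) :
    K0Var.cls (openVariety (Option A) U) = K0Var.cls (openVariety A (affZero A ⁻¹ᵁ U)) +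
      K0Var.cls (openVariety A V) * (lefschetz - 1) := by
  have hcyl := cls_openVariety_option A (affProj A ⁻¹ᵁ V)
  rw [affZero_preimage_affProj, cls_preimage_affProj, ← hV] at hcyl
  rw [cls_openVariety_option A U, ← sub_eq_iff_eq_add'.2 hcyl, mul_sub_one]

/-- The prime ideal of a point of affine space. -/
noncomputable def pointIdeal {A : Type} (p : affSch A) : Ideal (MvPolynomial A ℂ) :=
  PrimeSpectrum.asIdeal (R := MvPolynomial A ℂ) p

open Classical in
/-- The set of the coordinates that do not vanish at a point of affine space. It determines the
orbit of the coordinate torus in which the point lies. -/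
noncomputable def coordSupport {A : Type} [Fintype A] (p : affSch A) : Finset A :=
  {a | MvPolynomial.X a ∉ pointIdeal p}

theorem mem_coordSupport {A : Type} [Fintype A] {p : affSch A} {a : A} :
    a ∈ coordSupport p ↔ MvPolynomial.X a ∉ pointIdeal p := by
  simp [coordSupport]

theorem mem_coordSupport_affMap {A B : Type} [Fintype B] {f : B → MvPolynomial A ℂ}
    {p : affSch A} {b : B} : b ∈ coordSupport (affMap f p) ↔ f b ∉ pointIdeal p := by
  have : b ∈ coordSupport (affMap f p) ↔
      MvPolynomial.aeval f (MvPolynomial.X b : MvPolynomial B ℂ) ∉ pointIdeal p :=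
    mem_coordSupport
  rw [this, MvPolynomial.aeval_X]

theorem coordSupport_affMap_equiv {A B : Type} [Fintype A] [Fintype B] (e : A ≃ B)
    (p : affSch A) :
    coordSupport (affMap (fun b => MvPolynomial.X (e.symm b)) p) =
      (coordSupport p).map e.toEmbedding := by
  ext b
  rw [mem_coordSupport_affMap, Finset.mem_map_equiv, mem_coordSupport]

theorem coordSupport_affZero {A : Type} [Fintype A] (p : affSch A) :
    coordSupport (affZero A p) = (coordSupport p).map .some := by
  ext (_ | a) <;> rw [mem_coordSupport_affMap] <;> simp [mem_coordSupport]

theorem coordSupport_affOne {A : Type} [Fintype A] (p : affSch A) :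
    coordSupport (affOne A p) = Finset.insertNone (coordSupport p) := by
  ext (_ | a)
  · exact iff_of_true (mem_coordSupport_affMap.2 fun h =>
      (PrimeSpectrum.isPrime _).ne_top ((Ideal.eq_top_iff_one _).2 h)) (by simp)
  · rw [mem_coordSupport_affMap]
    simp [mem_coordSupport]

theorem coordSupport_affOne_affProj {A : Type} [Fintype A] {p : affSch (Option A)}
    (hp : p ∈ coordOpen none) : coordSupport (affOne A (affProj A p)) = coordSupport p := by
  rw [coordSupport_affOne]
  ext (_ | a)
  · exact iff_of_true (by simp) (mem_coordSupport.2 hp)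
  · rw [Finset.some_mem_insertNone, mem_coordSupport_affMap, mem_coordSupport]

theorem inf_coordOpen_eq {A : Type} [Fintype A] (F : Finset (Option A) → Prop)
    (U : (affSch (Option A)).Opens)
    (hU : ∀ p : affSch (Option A), p ∈ U ↔ F (coordSupport p)) :
    U ⊓ coordOpen none = (affProj A ⁻¹ᵁ (affOne A ⁻¹ᵁ U)) ⊓ coordOpen none := by
  refine TopologicalSpace.Opens.ext (Set.ext fun p => and_congr_left fun hp => ?_)
  rw [SetLike.mem_coe, SetLike.mem_coe, Scheme.Hom.mem_preimage, Scheme.Hom.mem_preimage,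
    hU, hU, coordSupport_affOne_affProj hp]

theorem sum_finset_option {A M : Type*} [Fintype A] [AddCommMonoid M]
    (f : Finset (Option A) → M) :
    ∑ S, f S = ∑ S : Finset A, f (S.map .some) + ∑ S : Finset A, f (Finset.insertNone S) := by
  classical
  rw [← Finset.sum_filter_not_add_sum_filter Finset.univ (none ∈ ·)]
  congr 1
  · refine Finset.sum_nbij' Finset.eraseNone (Finset.map .some) ?_ ?_ ?_ ?_ ?_
    all_goals simp +contextual [Finset.erase_eq_of_notMem]
  · refine Finset.sum_nbij' Finset.eraseNone Finset.insertNone ?_ ?_ ?_ ?_ ?_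
    all_goals simp +contextual [Finset.insert_eq_of_mem]

open Classical in
theorem cls_openVariety_eq_sum (A : Type) [Fintype A] (F : Finset A → Prop)
    (U : (affSch A).Opens) (hU : ∀ p : affSch A, p ∈ U ↔ F (coordSupport p)) :
    K0Var.cls (openVariety A U) = ∑ S with F S, (lefschetz - 1) ^ S.card := by
  revert F U hU
  refine Fintype.induction_empty_option (P := fun A _ => ∀ (F : Finset A → Prop)
    (U : (affSch A).Opens), (∀ p : affSch A, p ∈ U ↔ F (coordSupport p)) →
    K0Var.cls (openVariety A U) = ∑ S with F S, (lefschetz - 1) ^ S.card) ?_ ?_ ?_ A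
  · intro A B _ e ih F U hU
    let := Fintype.ofEquiv B e.symm
    rw [← cls_openVariety_equiv e U, ih (fun S => F (S.map e.toEmbedding)) _ fun p => by
      rw [Scheme.Hom.mem_preimage, hU, coordSupport_affMap_equiv], Finset.sum_filter,
      Finset.sum_filter]
    exact Fintype.sum_equiv e.finsetCongr _ _ fun S => by simp
  · intro F U hU
    rw [Finset.sum_filter, Fintype.sum_unique]
    by_cases h : F default
    · have : U = ⊤ := TopologicalSpace.Opens.ext (Set.ext fun p =>
        iff_of_true ((hU p).2 (by rwa [Subsingleton.elim (coordSupport p) default])) trivial)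
      rw [this, cls_openVariety_top_of_isEmpty, if_pos h]
      exact (pow_zero _).symm
    · have : U = ⊥ := TopologicalSpace.Opens.ext (Set.ext fun p =>
        iff_of_false (fun hp => h (by
          rw [Subsingleton.elim default (coordSupport p)]
          exact (hU p).1 hp)) id)
      rw [this, cls_openVariety_bot, if_neg h]
  · intro A _ ih F U hU
    rw [cls_openVariety_slice A U _ (inf_coordOpen_eq F U hU),
      ih (fun S => F (S.map .some)) _ fun p => by
        rw [Scheme.Hom.mem_preimage, hU, coordSupport_affZero],
      ih (fun S => F (Finset.insertNone S)) _ fun p => by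
        rw [Scheme.Hom.mem_preimage, hU, coordSupport_affOne]]
    simp only [Finset.sum_filter, sum_finset_option, Finset.card_map, Finset.card_insertNone,
      Finset.sum_mul, ite_mul, zero_mul, pow_succ]

open Classical in
theorem motV_cls_openVariety_eq_sum (A : Type) [Fintype A] (F : Finset A → Prop)
    (U : (affSch A).Opens) (hU : ∀ p : affSch A, p ∈ U ↔ F (coordSupport p)) :
    MotV.cls (openVariety A U) =
      algebraMap HalfField MotV (∑ S with F S, (HalfField.t ^ 2 - 1) ^ S.card) := by
  rw [← K0Var.toMotV_cls, cls_openVariety_eq_sum A F U hU]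
  simp only [map_sum, map_pow, map_sub, K0Var.toMotV_lefschetz, map_one]

/-! ### Relations and the Harder–Narasimhan recursion -/

/-- The set `T` of vertices is closed under the relation `E`: it supports a subrepresentation of
the abelian representations whose nonzero arrows join the pairs in `E`. -/
def IsClosedUnder {W : Type*} (E : Finset (W × W)) (T : Finset W) : Prop :=
  ∀ p ∈ E, p.1 ∈ T → p.2 ∈ T

/-- Every nonempty subset of `X` closed under the relation `E` has the property `D`. -/
def ForallClosed {W : Type*} (D : Finset W → Prop) (X : Finset W) (E : Finset (W × W)) : Prop :=
  ∀ T ⊆ X, T.Nonempty → IsClosedUnder E T → D T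

open Classical in
/-- The weighted number of the relations on `X` whose nonempty closed subsets all have the
property `D`. With `w p + 1 = q ^ r p`, it counts the abelian representations with `r p` arrows
between the vertices of the pair `p` all of whose nonzero subrepresentations satisfy `D`. -/
noncomputable def relationSum {W R : Type*} [CommSemiring R] (w : W × W → R)
    (D : Finset W → Prop) (X : Finset W) : R :=
  ∑ E ∈ (X ×ˢ X).powerset with ForallClosed D X E, ∏ p ∈ E, w p

section Relations

variable {W R : Type*} [DecidableEq W] [CommSemiring R]

/-- The part of a relation inside `T`. -/
def relIn (T : Finset W) (E : Finset (W × W)) : Finset (W × W) :=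
  {p ∈ E | p.1 ∈ T ∧ p.2 ∈ T}

/-- The part of a relation outside `T`. -/
def relOut (T : Finset W) (E : Finset (W × W)) : Finset (W × W) :=
  {p ∈ E | p.1 ∉ T ∧ p.2 ∉ T}

/-- The part of a relation that leads into `T` from outside. -/
def relInto (T : Finset W) (E : Finset (W × W)) : Finset (W × W) :=
  {p ∈ E | p.1 ∉ T ∧ p.2 ∈ T}

variable {X T N : Finset W} {E E₁ E₂ E₃ : Finset (W × W)}

theorem IsClosedUnder.inter (hT : IsClosedUnder E T) (hN : IsClosedUnder E N) :
    IsClosedUnder E (T ∩ N) := fun p hp h =>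
  Finset.mem_inter.2 ⟨hT p hp (Finset.mem_inter.1 h).1, hN p hp (Finset.mem_inter.1 h).2⟩

theorem IsClosedUnder.union (hT : IsClosedUnder E T) (hN : IsClosedUnder E N) :
    IsClosedUnder E (T ∪ N) := fun p hp h =>
  Finset.mem_union.2 ((Finset.mem_union.1 h).imp (hT p hp) (hN p hp))

theorem isClosedUnder_relIn_iff (hT : IsClosedUnder E T) (hN : N ⊆ T) :
    IsClosedUnder (relIn T E) N ↔ IsClosedUnder E N := by
  simp only [IsClosedUnder, relIn, Finset.mem_filter]
  exact ⟨fun h p hp hp1 => h p ⟨hp, hN hp1, hT p hp (hN hp1)⟩ hp1, fun h p hp => h p hp.1⟩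

theorem isClosedUnder_relOut_iff (hT : IsClosedUnder E T) (hN : Disjoint T N) :
    IsClosedUnder (relOut T E) N ↔ IsClosedUnder E (T ∪ N) := by
  have hdisj : ∀ i ∈ N, i ∉ T := fun i hi hi' => Finset.disjoint_left.1 hN hi' hi
  simp only [IsClosedUnder, relOut, Finset.mem_filter, Finset.mem_union] at hT ⊢
  refine forall_congr' fun p => ?_
  have := hT p
  have := hdisj p.1
  have := hdisj p.2
  tauto

theorem relIn_union_relOut_union_relInto (h : IsClosedUnder E T) :
    relIn T E ∪ relOut T E ∪ relInto T E = E := by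
  ext p
  have := h p
  simp only [relIn, relOut, relInto, Finset.mem_union, Finset.mem_filter]
  tauto

theorem relIn_subset_product : relIn T E ⊆ T ×ˢ T := fun _ hp =>
  Finset.mem_product.2 (Finset.mem_filter.1 hp).2

theorem relOut_subset_product (hE : E ⊆ X ×ˢ X) : relOut T E ⊆ (X \ T) ×ˢ (X \ T) := by
  intro p hp
  obtain ⟨hp, h1, h2⟩ := Finset.mem_filter.1 hp
  have := Finset.mem_product.1 (hE hp)
  exact Finset.mem_product.2 ⟨Finset.mem_sdiff.2 ⟨this.1, h1⟩, Finset.mem_sdiff.2 ⟨this.2, h2⟩⟩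

theorem relInto_subset_product (hE : E ⊆ X ×ˢ X) : relInto T E ⊆ (X \ T) ×ˢ T := by
  intro p hp
  obtain ⟨hp, h1, h2⟩ := Finset.mem_filter.1 hp
  exact Finset.mem_product.2 ⟨Finset.mem_sdiff.2 ⟨(Finset.mem_product.1 (hE hp)).1, h1⟩, h2⟩

section Pieces

variable (h₁ : E₁ ⊆ T ×ˢ T) (h₂ : E₂ ⊆ (X \ T) ×ˢ (X \ T)) (h₃ : E₃ ⊆ (X \ T) ×ˢ T)

include h₁ h₂ h₃

theorem mem_pieces (p : W × W) : (p ∈ E₁ → p.1 ∈ T ∧ p.2 ∈ T) ∧ (p ∈ E₂ → p.1 ∉ T ∧ p.2 ∉ T) ∧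
    (p ∈ E₃ → p.1 ∉ T ∧ p.2 ∈ T) :=
  ⟨fun h => Finset.mem_product.1 (h₁ h),
    fun h => ⟨(Finset.mem_sdiff.1 (Finset.mem_product.1 (h₂ h)).1).2,
      (Finset.mem_sdiff.1 (Finset.mem_product.1 (h₂ h)).2).2⟩,
    fun h => ⟨(Finset.mem_sdiff.1 (Finset.mem_product.1 (h₃ h)).1).2,
      (Finset.mem_product.1 (h₃ h)).2⟩⟩

theorem relIn_pieces : relIn T (E₁ ∪ E₂ ∪ E₃) = E₁ := by
  ext p
  have := mem_pieces h₁ h₂ h₃ p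
  simp only [relIn, Finset.mem_union, Finset.mem_filter]
  tauto

theorem relOut_pieces : relOut T (E₁ ∪ E₂ ∪ E₃) = E₂ := by
  ext p
  have := mem_pieces h₁ h₂ h₃ p
  simp only [relOut, Finset.mem_union, Finset.mem_filter]
  tauto

theorem relInto_pieces : relInto T (E₁ ∪ E₂ ∪ E₃) = E₃ := by
  ext p
  have := mem_pieces h₁ h₂ h₃ p
  simp only [relInto, Finset.mem_union, Finset.mem_filter]
  tauto

theorem isClosedUnder_pieces : IsClosedUnder (E₁ ∪ E₂ ∪ E₃) T := by
  intro p
  have := mem_pieces h₁ h₂ h₃ p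
  simp only [Finset.mem_union]
  tauto

theorem prod_pieces (w : W × W → R) :
    ∏ p ∈ E₁ ∪ E₂ ∪ E₃, w p = (∏ p ∈ E₁, w p) * (∏ p ∈ E₂, w p) * ∏ p ∈ E₃, w p := by
  rw [Finset.prod_union, Finset.prod_union]
  · refine Finset.disjoint_left.2 fun p => ?_
    have := mem_pieces h₁ h₂ h₃ p
    tauto
  · refine Finset.disjoint_left.2 fun p => ?_
    have := mem_pieces h₁ h₂ h₃ p
    simp only [Finset.mem_union]
    tauto

theorem pieces_subset_product (hTX : T ⊆ X) : E₁ ∪ E₂ ∪ E₃ ⊆ X ×ˢ X :=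
  Finset.union_subset (Finset.union_subset
    (h₁.trans (Finset.product_subset_product hTX hTX))
    (h₂.trans (Finset.product_subset_product Finset.sdiff_subset Finset.sdiff_subset)))
    (h₃.trans (Finset.product_subset_product Finset.sdiff_subset hTX))

end Pieces

variable {G : Type*} [AddCommMonoid G] [PartialOrder G] {θ : W → G} {T' : Finset W}

/-- `T` is the maximal destabilizing subset of the relation `E` on `X` for the stability `θ`: it is
closed of weight `0`, the closed subsets inside have nonnegative weights, and those of the
quotient have positive weights. -/
structure IsMaxDestabilizing (θ : W → G) (X : Finset W) (E : Finset (W × W)) (T : Finset W) :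
    Prop where
  subset : T ⊆ X
  sum_eq_zero : ∑ i ∈ T, θ i = 0
  closed : IsClosedUnder E T
  inside : ForallClosed (fun N => 0 ≤ ∑ i ∈ N, θ i) T (relIn T E)
  outside : ForallClosed (fun N => 0 < ∑ i ∈ N, θ i) (X \ T) (relOut T E)

theorem IsMaxDestabilizing.nonneg_of_subset (hT : IsMaxDestabilizing θ X E T) (hN : N ⊆ T)
    (hcl : IsClosedUnder E N) : 0 ≤ ∑ i ∈ N, θ i := by
  rcases N.eq_empty_or_nonempty with rfl | hne
  · rw [Finset.sum_empty]
  · exact hT.inside N hN hne ((isClosedUnder_relIn_iff hT.closed hN).2 hcl)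

theorem IsMaxDestabilizing.pos_sdiff (hT : IsMaxDestabilizing θ X E T) (hN : N ⊆ X)
    (hcl : IsClosedUnder E N) (hne : (N \ T).Nonempty) : 0 < ∑ i ∈ N \ T, θ i := by
  refine hT.outside _ (Finset.sdiff_subset_sdiff hN subset_rfl) hne
    ((isClosedUnder_relOut_iff hT.closed Finset.disjoint_sdiff).2 ?_)
  rw [Finset.union_sdiff_self_eq_union]
  exact hT.closed.union hcl

theorem IsMaxDestabilizing.forallClosed [IsOrderedAddMonoid G]
    (hT : IsMaxDestabilizing θ X E T) :
    ForallClosed (fun N => 0 ≤ ∑ i ∈ N, θ i) X E := by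
  intro N hN _ hcl
  rw [← Finset.sum_inter_add_sum_sdiff N T]
  refine add_nonneg (hT.nonneg_of_subset Finset.inter_subset_right (hcl.inter hT.closed)) ?_
  rcases (N \ T).eq_empty_or_nonempty with h | h
  · rw [h, Finset.sum_empty]
  · exact (hT.pos_sdiff hN hcl h).le

theorem IsMaxDestabilizing.superset [IsOrderedAddMonoid G] (hT : IsMaxDestabilizing θ X E T)
    (hT' : IsMaxDestabilizing θ X E T') : T' ⊆ T := by
  rw [← Finset.sdiff_eq_empty_iff_subset]
  by_contra hne
  refine ((hT.pos_sdiff hT'.subset hT'.closed (Finset.nonempty_iff_ne_empty.2 hne)).trans_le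
    (le_add_of_nonneg_left
      (hT'.nonneg_of_subset Finset.inter_subset_left (hT'.closed.inter hT.closed)))).ne' ?_
  rw [Finset.sum_inter_add_sum_sdiff, hT'.sum_eq_zero]

theorem exists_isMaxDestabilizing (h : ForallClosed (fun N => 0 ≤ ∑ i ∈ N, θ i) X E) :
    ∃ T, IsMaxDestabilizing θ X E T := by
  classical
  obtain ⟨T, hT, hmax⟩ := Finset.exists_max_image
    (X.powerset.filter fun T => ∑ i ∈ T, θ i = 0 ∧ IsClosedUnder E T) Finset.card
    ⟨∅, by simp [IsClosedUnder]⟩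
  simp only [Finset.mem_filter, Finset.mem_powerset] at hT hmax
  obtain ⟨hTX, h0, hcl⟩ := hT
  refine ⟨T, hTX, h0, hcl, fun N hN hne hclN =>
    h N (hN.trans hTX) hne ((isClosedUnder_relIn_iff hcl hN).1 hclN), fun N hN hne hclN => ?_⟩
  have hdisj : Disjoint T N := Finset.disjoint_sdiff.mono_right hN
  have hclTN : IsClosedUnder E (T ∪ N) := (isClosedUnder_relOut_iff hcl hdisj).1 hclN
  have hsub : T ∪ N ⊆ X := Finset.union_subset hTX (hN.trans Finset.sdiff_subset)
  have hsum : ∑ i ∈ T ∪ N, θ i = ∑ i ∈ N, θ i := by rw [Finset.sum_union hdisj, h0, zero_add]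
  have hge : 0 ≤ ∑ i ∈ N, θ i := hsum ▸ h _ hsub (hne.mono Finset.subset_union_right) hclTN
  refine lt_of_le_of_ne hge fun heq => ?_
  have hcard := hmax _ ⟨hsub, hsum.trans heq.symm, hclTN⟩
  rw [Finset.card_union_of_disjoint hdisj] at hcard
  exact hne.card_pos.not_ge (by omega)

open Classical in
theorem sum_isMaxDestabilizing (w : W × W → R) (θ : W → G) (hTX : T ⊆ X)
    (hT : ∑ i ∈ T, θ i = 0) :
    (∑ E ∈ (X ×ˢ X).powerset with IsMaxDestabilizing θ X E T, ∏ p ∈ E, w p) =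
      relationSum w (fun N => 0 ≤ ∑ i ∈ N, θ i) T *
        relationSum w (fun N => 0 < ∑ i ∈ N, θ i) (X \ T) *
        ∏ p ∈ (X \ T) ×ˢ T, (1 + w p) := by
  rw [Finset.prod_one_add, relationSum, relationSum, Finset.sum_mul_sum, ← Finset.sum_product',
    Finset.sum_mul_sum, ← Finset.sum_product']
  refine Finset.sum_bij' (fun E _ => ((relIn T E, relOut T E), relInto T E))
    (fun q _ => q.1.1 ∪ q.1.2 ∪ q.2) ?_ ?_ ?_ ?_ ?_
  · intro E hE
    simp only [Finset.mem_filter, Finset.mem_powerset] at hE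
    simp only [Finset.mem_product, Finset.mem_filter, Finset.mem_powerset]
    exact ⟨⟨⟨relIn_subset_product, hE.2.inside⟩, relOut_subset_product hE.1, hE.2.outside⟩,
      relInto_subset_product hE.1⟩
  · rintro ⟨⟨E₁, E₂⟩, E₃⟩ hq
    simp only [Finset.mem_product, Finset.mem_filter, Finset.mem_powerset] at hq ⊢
    obtain ⟨⟨⟨h₁, hs₁⟩, ⟨h₂, hs₂⟩⟩, h₃⟩ := hq
    exact ⟨pieces_subset_product h₁ h₂ h₃ hTX, hTX, hT, isClosedUnder_pieces h₁ h₂ h₃,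
      by rwa [relIn_pieces h₁ h₂ h₃], by rwa [relOut_pieces h₁ h₂ h₃]⟩
  · intro E hE
    exact relIn_union_relOut_union_relInto (Finset.mem_filter.1 hE).2.closed
  · rintro ⟨⟨E₁, E₂⟩, E₃⟩ hq
    simp only [Finset.mem_product, Finset.mem_filter, Finset.mem_powerset] at hq
    obtain ⟨⟨⟨h₁, -⟩, ⟨h₂, -⟩⟩, h₃⟩ := hq
    simp only [relIn_pieces h₁ h₂ h₃, relOut_pieces h₁ h₂ h₃, relInto_pieces h₁ h₂ h₃]
  · intro E hE
    simp only [Finset.mem_filter, Finset.mem_powerset] at hE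
    rw [← prod_pieces relIn_subset_product (relOut_subset_product hE.1)
      (relInto_subset_product hE.1), relIn_union_relOut_union_relInto hE.2.closed]

open Classical in
theorem relationSum_nonneg_eq [IsOrderedAddMonoid G] (w : W × W → R) (θ : W → G)
    (X : Finset W) :
    relationSum w (fun N => 0 ≤ ∑ i ∈ N, θ i) X =
      ∑ T ∈ X.powerset with ∑ i ∈ T, θ i = 0,
        relationSum w (fun N => 0 ≤ ∑ i ∈ N, θ i) T *
          relationSum w (fun N => 0 < ∑ i ∈ N, θ i) (X \ T) *
          ∏ p ∈ (X \ T) ×ˢ T, (1 + w p) := by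
  have hfiber : ∀ T ∈ X.powerset.filter (∑ i ∈ ·, θ i = 0), _ = _ := fun T hT =>
    (sum_isMaxDestabilizing w θ (Finset.mem_powerset.1 (Finset.mem_filter.1 hT).1)
      (Finset.mem_filter.1 hT).2).symm
  rw [Finset.sum_congr rfl hfiber]
  simp only [relationSum, Finset.sum_filter (p := ForallClosed _ X),
    Finset.sum_filter (p := fun E => IsMaxDestabilizing θ X E _)]
  rw [Finset.sum_comm]
  refine Finset.sum_congr rfl fun E _ => ?_
  split_ifs with h
  · obtain ⟨T, hT⟩ := exists_isMaxDestabilizing h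
    rw [Finset.sum_eq_single T, if_pos hT]
    · exact fun T' _ hne => if_neg fun hT' => hne ((hT.superset hT').antisymm (hT'.superset hT))
    · exact fun hmem => (hmem (Finset.mem_filter.2
        ⟨Finset.mem_powerset.2 hT.subset, hT.sum_eq_zero⟩)).elim
  · exact (Finset.sum_eq_zero fun T _ => if_neg fun hT => h hT.forallClosed).symm

end Relations

/-! ### The motive of the stack of semistable abelian representations -/

theorem sum_finrank_ite_mul {W K k : Type*} [Fintype W] [DecidableEq W] [Semiring K] [Field k]
    (T : Finset W) (ζ : W → K) :
    ∑ i, (Module.finrank k ((if i ∈ T then ⊤ else ⊥ : Submodule k k)) : K) * ζ i =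
      ∑ i ∈ T, ζ i := by
  refine .trans (Finset.sum_congr rfl fun i _ => ?_)
    ((Finset.sum_ite_mem Finset.univ T ζ).trans (by rw [Finset.univ_inter]))
  by_cases hi : i ∈ T
  · rw [if_pos hi, if_pos hi, finrank_top, Module.finrank_self, Nat.cast_one, one_mul]
  · rw [if_neg hi, if_neg hi, finrank_bot, Nat.cast_zero, zero_mul]

theorem forall_mem_ite_iff {W k : Type} [DecidableEq W] [Field k] {r : W → W → ℕ}
    (c : QArrow r → k) (T : Finset W) :
    (∀ a : QArrow r, ∀ x ∈ (if a.1.1 ∈ T then ⊤ else ⊥ : Submodule k k),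
      c a * x ∈ (if a.1.2 ∈ T then ⊤ else ⊥ : Submodule k k)) ↔
    ∀ a, c a ≠ 0 → a.1.1 ∈ T → a.1.2 ∈ T := by
  refine forall_congr' fun a => ?_
  by_cases h1 : a.1.1 ∈ T <;> by_cases h2 : a.1.2 ∈ T
  · simp [h1, h2]
  · simp only [h1, h2, if_true, if_false, Submodule.mem_bot, mul_eq_zero]
    exact ⟨fun h hc => by simpa [hc] using h 1 trivial, fun h => by tauto⟩
  · simp [h1, h2]
  · simp [h1, h2]

theorem isSemistableRep_iff {W : Type} [Fintype W] (r : W → W → ℕ) (ζ : W → ℂ)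
    {k : Type} [Field k] (c : QArrow r → k) :
    IsSemistableRep r ζ c ↔ ∀ T : Finset W, T.Nonempty →
      (∀ a, c a ≠ 0 → a.1.1 ∈ T → a.1.2 ∈ T) → zslope (∑ i ∈ T, ζ i) ≤ zslope (∑ i, ζ i) := by
  classical
  have hnonempty : ∀ T : Finset W,
      (∃ i, (if i ∈ T then ⊤ else ⊥ : Submodule k k) ≠ ⊥) ↔ T.Nonempty := fun T =>
    exists_congr fun i => ite_ne_right_iff.trans (and_iff_left top_ne_bot)
  constructor
  · intro h T hne hcl
    rw [← sum_finrank_ite_mul (k := k)]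
    exact h _ ((forall_mem_ite_iff c T).2 hcl) ((hnonempty T).2 hne)
  · intro h N hcl hne
    obtain ⟨T, rfl⟩ : ∃ T : Finset W, (fun i => if i ∈ T then ⊤ else ⊥) = N := by
      refine ⟨Finset.univ.filter (N · ≠ ⊥), funext fun i => ?_⟩
      have hmem : i ∈ Finset.univ.filter (N · ≠ ⊥) ↔ N i ≠ ⊥ := Finset.mem_filter_univ i
      by_cases hi : N i = ⊥
      · rw [if_neg fun h => hmem.1 h hi, hi]
      · rw [if_pos (hmem.2 hi), (Ideal.eq_bot_or_top (N i)).resolve_left hi]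
    rw [sum_finrank_ite_mul]
    exact h T ((hnonempty T).1 hne) ((forall_mem_ite_iff c T).1 hcl)

theorem sum_nonempty_pow_card {κ R : Type*} [Fintype κ] [CommRing R] (y : R) :
    ∑ S : Finset κ with S.Nonempty, y ^ S.card = (1 + y) ^ Fintype.card κ - 1 := by
  classical
  rw [add_comm, ← Fintype.sum_pow_mul_eq_add_pow, eq_sub_iff_add_eq,
    ← Finset.sum_filter_add_sum_filter_not Finset.univ Finset.Nonempty]
  simp [Finset.filter_eq']

open Classical in
theorem sum_image_fst_eq {ι R : Type*} [Fintype ι] [DecidableEq ι] [CommRing R]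
    {κ : ι → Type*} [∀ i, Fintype (κ i)] (E : Finset ι) (y : R) :
    ∑ S : Finset (Σ i, κ i) with S.image Sigma.fst = E, y ^ S.card =
      ∏ i ∈ E, ((1 + y) ^ Fintype.card (κ i) - 1) := by
  have hfiber : ∀ i, (∑ S : Finset (κ i) with (S.Nonempty ↔ i ∈ E), y ^ S.card) =
      if i ∈ E then (1 + y) ^ Fintype.card (κ i) - 1 else 1 := by
    intro i
    split_ifs with hi
    · simp only [hi, iff_true, sum_nonempty_pow_card]
    · simp [hi, Finset.filter_eq']
  rw [← Finset.univ_inter E, ← Finset.prod_ite_mem, ← Finset.prod_congr rfl fun i _ => hfiber i,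
    Finset.prod_univ_sum, Finset.univ_inter]
  refine Finset.sum_bij' (fun S _ i => S.preimage (Sigma.mk i) sigma_mk_injective.injOn)
    (fun S _ => Finset.univ.sigma S) ?_ ?_ ?_ ?_ ?_
  · intro S hS
    rw [← (Finset.mem_filter.1 hS).2]
    simp [Fintype.mem_piFinset, Finset.Nonempty]
  · intro S hS
    simp only [Fintype.mem_piFinset, Finset.mem_filter_univ] at hS
    refine Finset.mem_filter.2 ⟨Finset.mem_univ _, Finset.ext fun i => ?_⟩
    simp [← hS, Finset.Nonempty]
  · exact fun S _ => Finset.sigma_preimage_mk_of_subset S (Finset.subset_univ _)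
  · intro S _
    ext i x
    simp
  · intro S _
    rw [Finset.prod_pow_eq_pow_sum, ← Finset.card_sigma,
      Finset.sigma_preimage_mk_of_subset S (Finset.subset_univ _)]

open Classical in
theorem sum_image_fst {ι R : Type*} [Fintype ι] [DecidableEq ι] [CommRing R]
    {κ : ι → Type*} [∀ i, Fintype (κ i)] (F : Finset ι → Prop) (y : R) :
    ∑ S : Finset (Σ i, κ i) with F (S.image Sigma.fst), y ^ S.card =
      ∑ E : Finset ι with F E, ∏ i ∈ E, ((1 + y) ^ Fintype.card (κ i) - 1) := by
  rw [← Finset.sum_fiberwise_of_maps_to (t := Finset.univ.filter F)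
    (g := fun S : Finset (Σ i, κ i) => S.image Sigma.fst) fun S hS => by simpa using hS]
  refine Finset.sum_congr rfl fun E hE => ?_
  rw [← sum_image_fst_eq, Finset.filter_filter]
  refine Finset.sum_congr (Finset.filter_congr fun S _ => ?_) fun S _ => rfl
  exact and_iff_right_of_imp fun h => h ▸ (Finset.mem_filter.1 hE).2

theorem isClosedUnder_image_fst_iff {W : Type} [DecidableEq W] {r : W → W → ℕ}
    (S : Finset (QArrow r)) (T : Finset W) :
    IsClosedUnder (S.image Sigma.fst) T ↔ ∀ a ∈ S, a.1.1 ∈ T → a.1.2 ∈ T := by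
  simp only [IsClosedUnder, Finset.forall_mem_image]

theorem fAbelian_eq {W : Type} [Fintype W] (r : W → W → ℕ) (ζ : W → ℂ) :
    fAbelian r ζ = algebraMap HalfField MotV
      (HalfField.t ^ ((Fintype.card W : ℤ) - (Fintype.card (QArrow r) : ℤ)) *
        ((HalfField.t ^ 2 - 1) ^ Fintype.card W)⁻¹ *
      relationSum (fun p => (HalfField.t ^ 2) ^ r p.1 p.2 - 1)
        (fun T => zslope (∑ i ∈ T, ζ i) ≤ zslope (∑ i, ζ i)) Finset.univ) := by
  classical
  let F : Finset (W × W) → Prop :=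
    ForallClosed (fun T => zslope (∑ i ∈ T, ζ i) ≤ zslope (∑ i, ζ i)) Finset.univ
  have hlocus : ∀ p, p ∈ semistableLocus r ζ ↔ F ((coordSupport p).image Sigma.fst) := by
    intro p
    have hcoord : ∀ a, pointRep p a ≠ 0 ↔ a ∈ coordSupport p := fun a =>
      (not_congr (pointRep_eq_zero p a)).trans mem_coordSupport.symm
    refine (isSemistableRep_iff r ζ (pointRep p)).trans (forall_congr' fun T => ?_)
    simp only [hcoord, Finset.subset_univ, true_imp_iff, isClosedUnder_image_fst_iff]
  rw [fAbelian, motV_cls_openVariety_eq_sum (QArrow r) (fun S => F (S.image Sigma.fst)) _ hlocus,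
    sum_image_fst F, Algebra.smul_def, ← map_mul, relationSum, Finset.univ_product_univ,
    Finset.powerset_univ]
  simp only [add_sub_cancel, Fintype.card_fin, F]

/-! ### Counting by dimension vectors -/

section DimVec

variable {V W W' : Type*}

/-- The dimension vector of a set of vertices labelled by the vertices of a quiver. -/
noncomputable def dimVec (lab : W → V) (X : Finset W) : V →₀ ℕ :=
  ∑ i ∈ X, Finsupp.single (lab i) 1

theorem map_dimVec {G : Type*} [AddCommMonoid G] (θ : (V →₀ ℕ) →+ G) (lab : W → V)
    (X : Finset W) : θ (dimVec lab X) = ∑ i ∈ X, θ (Finsupp.single (lab i) 1) :=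
  map_sum _ _ _

theorem dimVec_mono (lab : W → V) {X T : Finset W} (h : T ⊆ X) : dimVec lab T ≤ dimVec lab X :=
  Finset.sum_le_sum_of_subset h

theorem dimVec_eq_zero {lab : W → V} {X : Finset W} : dimVec lab X = 0 ↔ X = ∅ := by
  simp [dimVec, Finset.sum_eq_zero_iff, Finset.eq_empty_iff_forall_notMem]

theorem dimVec_insert [DecidableEq W] (lab : W → V) {X : Finset W} {a : W} (ha : a ∉ X) :
    dimVec lab (insert a X) = dimVec lab X + Finsupp.single (lab a) 1 :=
  (Finset.sum_insert ha).trans (add_comm _ _)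

theorem dimVec_map (lab : W' → V) (f : W ↪ W') (X : Finset W) :
    dimVec lab (X.map f) = dimVec (lab ∘ f) X :=
  Finset.sum_map _ _ _

theorem dimVec_apply [DecidableEq V] (lab : W → V) (X : Finset W) (i : V) :
    dimVec lab X i = (X.filter (lab · = i)).card := by
  rw [dimVec, Finset.card_filter, Finsupp.finsetSum_apply]
  exact Finset.sum_congr rfl fun u _ => by rw [Finsupp.single_apply]

theorem card_fiber_eq_dimVec (lab : W → V) (X : Finset W) (i : V) :
    Nat.card {x : X // lab x = i} = dimVec lab X i := by
  classical
  rw [dimVec_apply, ← Fintype.card_coe, ← Nat.card_eq_fintype_card]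
  exact Nat.card_congr ((Equiv.subtypeSubtypeEquivSubtypeInter (· ∈ X) (lab · = i)).trans
    (Equiv.subtypeEquivRight fun _ => by rw [Finset.mem_filter]))

theorem exists_equiv_of_dimVec_eq {lab : W → V} {lab' : W' → V} {X : Finset W} {Y : Finset W'}
    (h : dimVec lab X = dimVec lab' Y) : ∃ e : X ≃ Y, ∀ x, lab' (e x) = lab x := by
  have hfiber : ∀ i : V, Nonempty ({x : X // lab x = i} ≃ {y : Y // lab' y = i}) := fun i => by
    rw [← Finite.card_eq, card_fiber_eq_dimVec, card_fiber_eq_dimVec, h]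
  exact ⟨(Equiv.sigmaFiberEquiv fun x : X => lab x).symm.trans
    ((Equiv.sigmaCongrRight fun i => (hfiber i).some).trans
      (Equiv.sigmaFiberEquiv fun y : Y => lab' y)),
    fun x => ((hfiber (lab x)).some ⟨x, rfl⟩).2⟩

theorem isClosedUnder_map {f : W ↪ W'} {E : Finset (W × W)} {T : Finset W} :
    IsClosedUnder (E.map (f.prodMap f)) (T.map f) ↔ IsClosedUnder E T := by
  constructor
  · intro h p hp hpT
    exact (Finset.mem_map' f).1
      (h _ (Finset.mem_map_of_mem (f.prodMap f) hp) (Finset.mem_map_of_mem f hpT))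
  · rintro h _ hq hqT
    obtain ⟨p, hp, rfl⟩ := Finset.mem_map.1 hq
    exact Finset.mem_map_of_mem f (h p hp ((Finset.mem_map' f).1 hqT))

theorem forallClosed_map {D : Finset W' → Prop} {f : W ↪ W'} {X : Finset W}
    {E : Finset (W × W)} :
    ForallClosed D (X.map f) (E.map (f.prodMap f)) ↔ ForallClosed (fun T => D (T.map f)) X E := by
  constructor
  · exact fun h T hT hne hcl =>
      h _ (Finset.map_subset_map.2 hT) hne.map (isClosedUnder_map.2 hcl)
  · intro h T hT hne hcl
    obtain ⟨T, hTX, rfl⟩ := Finset.subset_map_iff.1 hT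
    exact h T hTX (Finset.map_nonempty.1 hne) (isClosedUnder_map.1 hcl)

variable {R : Type*}

theorem relationSum_map [CommSemiring R] (w : W' × W' → R) (D : Finset W' → Prop) (f : W ↪ W')
    (X : Finset W) :
    relationSum w D (X.map f) =
      relationSum (fun p => w (p.map f f)) (fun T => D (T.map f)) X := by
  classical
  symm
  refine Finset.sum_bij (fun E _ => E.map (f.prodMap f)) ?_
    (fun E _ E' _ h => Finset.map_injective _ h) ?_
    fun E _ => (Finset.prod_map E (f.prodMap f) w).symm
  · intro E hE
    rw [Finset.mem_filter, Finset.mem_powerset] at hE ⊢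
    rw [← Finset.prodMap_map_product]
    exact ⟨Finset.map_subset_map.2 hE.1, forallClosed_map.2 hE.2⟩
  · intro E hE
    rw [Finset.mem_filter, Finset.mem_powerset, ← Finset.prodMap_map_product] at hE
    obtain ⟨E, hEX, rfl⟩ := Finset.subset_map_iff.1 hE.1
    exact ⟨E, Finset.mem_filter.2 ⟨Finset.mem_powerset.2 hEX, forallClosed_map.1 hE.2⟩, rfl⟩

theorem relationSum_congr [CommSemiring R] (w : W × W → R) {D D' : Finset W → Prop}
    {X : Finset W} (h : ∀ T ⊆ X, T.Nonempty → (D T ↔ D' T)) :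
    relationSum w D X = relationSum w D' X := by
  classical
  rw [relationSum, relationSum]
  refine Finset.sum_congr (Finset.filter_congr fun E _ => ?_) fun _ _ => rfl
  exact forall₃_congr fun T hT hne => imp_congr_right fun _ => h T hT hne

theorem relationSum_false [CommSemiring R] (w : W × W → R) {X : Finset W} (hX : X.Nonempty) :
    relationSum w (fun _ => False) X = 0 := by
  classical
  rw [relationSum, Finset.filter_false_of_mem, Finset.sum_empty]
  intro E hE h
  exact h X subset_rfl hX fun p hp _ =>
    (Finset.mem_product.1 (Finset.mem_powerset.1 hE hp)).2

theorem relationSum_empty [CommSemiring R] (w : W × W → R) (D : Finset W → Prop) :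
    relationSum w D ∅ = 1 := by
  classical
  rw [relationSum, Finset.product_empty, Finset.powerset_empty, Finset.filter_true_of_mem,
    Finset.sum_singleton, Finset.prod_empty]
  exact fun E _ T hT hne => (hne.ne_empty (Finset.subset_empty.1 hT)).elim

theorem relationSum_eq_of_dimVec_eq [CommSemiring R] (w : V → V → R) (D : (V →₀ ℕ) → Prop)
    {lab : W → V} {lab' : W' → V} {X : Finset W} {Y : Finset W'}
    (h : dimVec lab X = dimVec lab' Y) :
    relationSum (fun p => w (lab p.1) (lab p.2)) (fun T => D (dimVec lab T)) X =
      relationSum (fun p => w (lab' p.1) (lab' p.2)) (fun T => D (dimVec lab' T)) Y := by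
  obtain ⟨e, he⟩ := exists_equiv_of_dimVec_eq h
  have hX : X = (Finset.univ : Finset X).map (.subtype _) := by
    rw [Finset.univ_eq_attach, Finset.attach_map_val]
  have hY : Y = (Finset.univ : Finset X).map (e.toEmbedding.trans (.subtype _)) := by
    rw [← Finset.map_map, Finset.univ_map_equiv_to_embedding, Finset.univ_eq_attach,
      Finset.attach_map_val]
  have hlab : lab' ∘ e.toEmbedding.trans (.subtype _) = lab ∘ Function.Embedding.subtype (· ∈ X) :=
    funext he
  rw [hX, hY, relationSum_map, relationSum_map]
  simp only [dimVec_map, hlab]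
  simp only [Prod.map_fst, Prod.map_snd, Function.Embedding.trans_apply,
    Function.Embedding.subtype_apply, Equiv.coe_toEmbedding, he]

/-- The vertices `i_k`, `1 ≤ k ≤ m i`, of the quiver `Q(m)`: a set with dimension vector `m`. -/
abbrev StdVertex (m : V →₀ ℕ) := Σ i : m.support, Fin (m i)

/-- The relations on `Q(m)` counted by `relationSum`, for weights and conditions that depend only
on the labels. -/
noncomputable def dimSum [CommSemiring R] (w : V → V → R) (D : (V →₀ ℕ) → Prop)
    (m : V →₀ ℕ) : R :=
  relationSum (fun p : StdVertex m × StdVertex m => w p.1.1 p.2.1)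
    (fun T => D (dimVec (fun x => (x.1 : V)) T)) Finset.univ

theorem dimVec_stdVertex (m : V →₀ ℕ) :
    dimVec (fun x : StdVertex m => (x.1 : V)) Finset.univ = m := by
  rw [dimVec, Fintype.sum_sigma]
  simp only [Finset.sum_const, Finset.card_univ, Fintype.card_fin, Finsupp.smul_single,
    smul_eq_mul, mul_one]
  exact (Finset.sum_coe_sort m.support fun i => Finsupp.single i (m i)).trans m.sum_single

theorem relationSum_eq_dimSum [CommSemiring R] (w : V → V → R) (D : (V →₀ ℕ) → Prop)
    (lab : W → V) (X : Finset W) :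
    relationSum (fun p => w (lab p.1) (lab p.2)) (fun T => D (dimVec lab T)) X =
      dimSum w D (dimVec lab X) :=
  relationSum_eq_of_dimVec_eq w D (dimVec_stdVertex _).symm

theorem dimSum_congr [CommSemiring R] (w : V → V → R) {D D' : (V →₀ ℕ) → Prop} {m : V →₀ ℕ}
    (h : ∀ m' ≤ m, m' ≠ 0 → (D m' ↔ D' m')) : dimSum w D m = dimSum w D' m :=
  relationSum_congr _ fun _ hT hne => h _ ((dimVec_mono _ hT).trans_eq (dimVec_stdVertex m))
    (dimVec_eq_zero.not.2 hne.ne_empty)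

theorem dimSum_zero [CommSemiring R] (w : V → V → R) (D : (V →₀ ℕ) → Prop) :
    dimSum w D 0 = 1 := by
  have : IsEmpty (StdVertex (0 : V →₀ ℕ)) := ⟨fun x => x.2.elim0⟩
  rw [dimSum, Finset.univ_eq_empty, relationSum_empty]

theorem dimSum_false [CommSemiring R] (w : V → V → R) {m : V →₀ ℕ} (hm : m ≠ 0) :
    dimSum w (fun _ => False) m = 0 := by
  refine relationSum_false _ (Finset.nonempty_iff_ne_empty.2 fun h => hm ?_)
  rw [← dimVec_stdVertex m, h, dimVec_eq_zero]

theorem sum_powerset_insert_dimVec {W A : Type*} [DecidableEq W] [AddCommMonoid A] (lab : W → V)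
    {X : Finset W} {a : W} (ha : a ∉ X) (φ : (V →₀ ℕ) → (V →₀ ℕ) → A) :
    ∑ T ∈ (insert a X).powerset, φ (dimVec lab T) (dimVec lab (insert a X \ T)) =
      ∑ T ∈ X.powerset, (φ (dimVec lab T) (dimVec lab (X \ T) + Finsupp.single (lab a) 1) +
        φ (dimVec lab T + Finsupp.single (lab a) 1) (dimVec lab (X \ T))) := by
  rw [Finset.sum_powerset_insert ha, ← Finset.sum_add_distrib]
  refine Finset.sum_congr rfl fun T hT => ?_
  have haT : a ∉ T := fun h => ha (Finset.mem_powerset.1 hT h)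
  rw [Finset.insert_sdiff_of_notMem _ haT,
    dimVec_insert lab fun h => ha (Finset.mem_sdiff.1 h).1, dimVec_insert lab haT,
    Finset.insert_sdiff_insert, Finset.sdiff_insert_of_notMem ha]

end DimVec

section MultiFactorial

variable {V : Type*}

/-- `m! = ∏ m(i)!` for a dimension vector `m`. -/
noncomputable def multiFactorial (m : V →₀ ℕ) : ℕ := m.prod fun _ k => k.factorial

theorem multiFactorial_ne_zero (m : V →₀ ℕ) : (multiFactorial m : ℚ) ≠ 0 :=
  Nat.cast_ne_zero.2 (Finset.prod_ne_zero_iff.2 fun _ _ => Nat.factorial_ne_zero _)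

theorem multiFactorial_zero : multiFactorial (0 : V →₀ ℕ) = 1 := Finsupp.prod_zero_index

theorem multiFactorial_add_single (m : V →₀ ℕ) (i : V) :
    multiFactorial (m + Finsupp.single i 1) = (m i + 1) * multiFactorial m := by
  classical
  have hsub : (m + Finsupp.single i 1).support ⊆ insert i m.support := fun j hj => by
    by_contra! h
    rw [Finset.mem_insert, not_or, Finsupp.notMem_support_iff] at h
    simp [h.2, Finsupp.single_eq_of_ne h.1] at hj
  rw [multiFactorial, multiFactorial, Finsupp.prod_of_support_subset _ hsub _ fun _ _ => rfl,
    Finsupp.prod_of_support_subset _ (Finset.subset_insert i _) _ fun _ _ => rfl,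
    ← Finset.mul_prod_erase _ _ (Finset.mem_insert_self i _),
    ← Finset.mul_prod_erase _ _ (Finset.mem_insert_self i _), Finsupp.add_apply,
    Finsupp.single_eq_same, Nat.factorial_succ, mul_assoc]
  refine congrArg _ (congrArg _ (Finset.prod_congr rfl fun j hj => ?_))
  rw [Finsupp.add_apply, Finsupp.single_eq_of_ne (Finset.ne_of_mem_erase hj), add_zero]

theorem add_one_mul_inv_multiFactorial (m : V →₀ ℕ) (i : V) :
    ((m i : ℚ) + 1) * (multiFactorial (m + Finsupp.single i 1) : ℚ)⁻¹ =
      (multiFactorial m : ℚ)⁻¹ := by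
  rw [multiFactorial_add_single, Nat.cast_mul, mul_inv, Nat.cast_succ,
    mul_inv_cancel_left₀ (Nat.cast_add_one_ne_zero _)]

variable [DecidableEq V] {A : Type*} [AddCommGroup A]

theorem sum_antidiagonal_add_single (m : V →₀ ℕ) (i : V) (f : (V →₀ ℕ) → (V →₀ ℕ) → A)
    (hf : ∀ p q, p i = 0 → f p q = 0) :
    ∑ p ∈ antidiagonal (m + Finsupp.single i 1), f p.1 p.2 =
      ∑ p ∈ antidiagonal m, f (p.1 + Finsupp.single i 1) p.2 := by
  symm
  refine Finset.sum_bij_ne_zero (fun p _ _ => (p.1 + Finsupp.single i 1, p.2)) ?_ ?_ ?_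
    fun _ _ _ => rfl
  · intro p hp _
    rw [mem_antidiagonal] at hp ⊢
    rw [← hp]
    exact add_right_comm _ _ _
  · rintro p _ _ q _ _ h
    rw [Prod.mk.injEq] at h
    exact Prod.ext (add_right_cancel h.1) h.2
  · intro p hp hfp
    have hpi : p.1 - Finsupp.single i 1 + Finsupp.single i 1 = p.1 :=
      tsub_add_cancel_of_le <| Finsupp.single_le_iff.2 <|
        Nat.one_le_iff_ne_zero.2 fun h => hfp (hf _ _ h)
    refine ⟨(p.1 - Finsupp.single i 1, p.2), ?_, by rwa [hpi], by rw [hpi]⟩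
    rw [mem_antidiagonal] at hp ⊢
    rw [← add_left_inj (Finsupp.single i 1), ← hp, add_right_comm, hpi]

theorem sum_antidiagonal_add_single' (m : V →₀ ℕ) (i : V) (f : (V →₀ ℕ) → (V →₀ ℕ) → A)
    (hf : ∀ p q, q i = 0 → f p q = 0) :
    ∑ p ∈ antidiagonal (m + Finsupp.single i 1), f p.1 p.2 =
      ∑ p ∈ antidiagonal m, f p.1 (p.2 + Finsupp.single i 1) := by
  rw [Finsupp.sum_antidiagonal_swap, Finsupp.sum_antidiagonal_swap m fun p q =>
    f p (q + Finsupp.single i 1)]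
  exact sum_antidiagonal_add_single m i (fun p q => f q p) fun p q => hf q p

variable [Module ℚ A]

/- The divided powers `x^m / m!` satisfy the Leibniz rule. -/
theorem sum_antidiagonal_inv_multiFactorial_add_single (m : V →₀ ℕ) (i : V)
    (φ : (V →₀ ℕ) → (V →₀ ℕ) → A) :
    ((m i : ℚ) + 1) • ∑ p ∈ antidiagonal (m + Finsupp.single i 1),
        ((multiFactorial p.1 : ℚ)⁻¹ * (multiFactorial p.2 : ℚ)⁻¹) • φ p.1 p.2 =
      ∑ p ∈ antidiagonal m, ((multiFactorial p.1 : ℚ)⁻¹ * (multiFactorial p.2 : ℚ)⁻¹) •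
        (φ p.1 (p.2 + Finsupp.single i 1) + φ (p.1 + Finsupp.single i 1) p.2) := by
  let F (p q : V →₀ ℕ) : A :=
    ((p i : ℚ) * (multiFactorial p : ℚ)⁻¹ * (multiFactorial q : ℚ)⁻¹) • φ p q
  let G (p q : V →₀ ℕ) : A :=
    ((multiFactorial p : ℚ)⁻¹ * ((q i : ℚ) * (multiFactorial q : ℚ)⁻¹)) • φ p q
  have hsplit : ∀ p ∈ antidiagonal (m + Finsupp.single i 1), ((m i : ℚ) + 1) •
      ((multiFactorial p.1 : ℚ)⁻¹ * (multiFactorial p.2 : ℚ)⁻¹) • φ p.1 p.2 =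
        G p.1 p.2 + F p.1 p.2 := by
    intro p hp
    have hi : (p.1 i + p.2 i : ℚ) = m i + 1 := by
      have := DFunLike.congr_fun (mem_antidiagonal.1 hp) i
      rw [Finsupp.add_apply, Finsupp.add_apply, Finsupp.single_eq_same] at this
      exact_mod_cast this
    rw [smul_smul, ← hi, ← add_smul]
    congr 1
    ring
  rw [Finset.smul_sum, Finset.sum_congr rfl hsplit, Finset.sum_add_distrib,
    sum_antidiagonal_add_single m i F fun p q h => by simp [F, h],
    sum_antidiagonal_add_single' m i G fun p q h => by simp [G, h], ← Finset.sum_add_distrib]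
  refine Finset.sum_congr rfl fun p _ => ?_
  simp only [F, G, Finsupp.add_apply, Finsupp.single_eq_same, Nat.cast_add, Nat.cast_one,
    add_one_mul_inv_multiFactorial, smul_add]

theorem sum_powerset_dimVec {W : Type*} [DecidableEq W] (lab : W → V) (X : Finset W)
    (φ : (V →₀ ℕ) → (V →₀ ℕ) → A) :
    ∑ T ∈ X.powerset, φ (dimVec lab T) (dimVec lab (X \ T)) =
      (multiFactorial (dimVec lab X) : ℚ) • ∑ p ∈ antidiagonal (dimVec lab X),
        ((multiFactorial p.1 : ℚ)⁻¹ * (multiFactorial p.2 : ℚ)⁻¹) • φ p.1 p.2 := by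
  induction X using Finset.induction_on generalizing φ with
  | empty => simp [dimVec, multiFactorial_zero]
  | insert a X ha ih =>
    rw [sum_powerset_insert_dimVec lab ha, dimVec_insert lab ha, multiFactorial_add_single,
      ih fun p q => φ p (q + Finsupp.single (lab a) 1) + φ (p + Finsupp.single (lab a) 1) q,
      ← sum_antidiagonal_inv_multiFactorial_add_single, smul_smul, Nat.cast_mul, Nat.cast_succ,
      mul_comm]

end MultiFactorial

/-! ### The Harder–Narasimhan factorisation -/

section HarderNarasimhan

theorem exists_mem_cons_iff_nonneg {ℓ G : Type*} [Zero G] [PartialOrder G] {x : ℓ → G} {l : ℓ}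
    {L : List ℓ} (hord : ∀ l' ∈ L, 0 ≤ x l' → 0 < x l) (hex : 0 ≤ x l → ∃ l' ∈ l :: L, x l' = 0) :
    ((∃ l' ∈ l :: L, x l' = 0) ↔ 0 ≤ x l) ∧ ((∃ l' ∈ L, x l' = 0) ↔ 0 < x l) := by
  simp only [List.mem_cons, exists_eq_or_imp] at hex ⊢
  refine ⟨⟨?_, hex⟩, ?_, fun h => (hex h.le).resolve_left h.ne'⟩
  · rintro (h | ⟨l', hl', h⟩)
    exacts [h.ge, (hord l' hl' h.ge).le]
  · rintro ⟨l', hl', h⟩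
    exact hord l' hl' h.ge

variable {V : Type} {R : Type*} [CommRing R]

theorem quiverForm_single (r : V → V → ℕ) (i j : V) :
    quiverForm r (Finsupp.single i 1) (Finsupp.single j 1) = r i j := by
  rw [quiverForm, Finsupp.sum_single_index, Finsupp.sum_single_index] <;> simp

theorem quiverForm_dimVec {W : Type*} (r : V → V → ℕ) (lab : W → V) (X Y : Finset W) :
    quiverForm r (dimVec lab X) (dimVec lab Y) = ∑ p ∈ X ×ˢ Y, r (lab p.1) (lab p.2) := by
  let form : (V →₀ ℕ) →+ (V →₀ ℕ) →+ ℕ :=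
    { toFun α := ⟨⟨quiverForm r α, by simp [quiverForm]⟩, quiverForm_add_right r α⟩
      map_zero' := AddMonoidHom.ext fun _ => by simp [quiverForm]
      map_add' α α' := AddMonoidHom.ext (quiverForm_add_left r α α') }
  change form (dimVec lab X) (dimVec lab Y) = _
  rw [Finset.sum_product, map_dimVec form, AddMonoidHom.finsetSum_apply]
  refine Finset.sum_congr rfl fun x _ => (map_dimVec _ lab Y).trans ?_
  exact Finset.sum_congr rfl fun y _ => quiverForm_single r _ _

/-- `q ^ r i j - 1`, where `q = v²`: the class of the nonzero vectors in the space of the arrows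
from `i` to `j`. -/
def arrowWeight (r : V → V → ℕ) (v : Rˣ) (i j : V) : R := ((v : R) ^ 2) ^ r i j - 1

/-- The factor `u^(-|m|) v^(-r(m,m))` which normalises the count of the representations of `Q(m)`,
where `u` and `v` play the roles of `q^{1/2} - q^{-1/2}` and `q^{1/2}`. -/
noncomputable def hnUnit (r : V → V → ℕ) (v u : Rˣ) (m : V →₀ ℕ) : Rˣ :=
  u ^ (-(m.degree : ℤ)) * v ^ (-(quiverForm r m m : ℤ))

theorem hnUnit_add (r : V → V → ℕ) (v u : Rˣ) (m m' : V →₀ ℕ) :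
    hnUnit r v u (m + m') * (v ^ 2) ^ quiverForm r m' m =
      v ^ quiverSkew r m m' * (hnUnit r v u m * hnUnit r v u m') := by
  have hskew : quiverSkew r m m' = (quiverForm r m' m : ℤ) - quiverForm r m m' := rfl
  rw [hnUnit, hnUnit, hnUnit, hskew, ← pow_mul, ← zpow_natCast v, mul_mul_mul_comm, ← zpow_add,
    ← zpow_add, mul_assoc, ← zpow_add, mul_left_comm, ← zpow_add, map_add]
  simp only [quiverForm_add_left, quiverForm_add_right]
  congr 2 <;> push_cast <;> ring

variable [Algebra ℚ R]

/-- The normalised count of the representations of `Q(m)`, divided by `m!`, such that the dimension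
vectors of all nonzero subrepresentations have the property `D`. -/
noncomputable def hnCoeff (r : V → V → ℕ) (v u : Rˣ) (D : (V →₀ ℕ) → Prop) (m : V →₀ ℕ) : R :=
  (multiFactorial m : ℚ)⁻¹ • (hnUnit r v u m * dimSum (arrowWeight r v) D m)

theorem hnCoeff_congr (r : V → V → ℕ) (v u : Rˣ) {D D' : (V →₀ ℕ) → Prop} {m : V →₀ ℕ}
    (h : ∀ m' ≤ m, m' ≠ 0 → (D m' ↔ D' m')) : hnCoeff r v u D m = hnCoeff r v u D' m := by
  rw [hnCoeff, hnCoeff, dimSum_congr _ h]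

theorem hnCoeff_zero (r : V → V → ℕ) (v u : Rˣ) (D : (V →₀ ℕ) → Prop) :
    hnCoeff r v u D 0 = 1 := by
  simp [hnCoeff, hnUnit, multiFactorial_zero, dimSum_zero, quiverForm]

theorem hnCoeff_false (r : V → V → ℕ) (v u : Rˣ) {m : V →₀ ℕ} (hm : m ≠ 0) :
    hnCoeff r v u (fun _ => False) m = 0 := by
  rw [hnCoeff, dimSum_false _ hm, mul_zero, smul_zero]

variable [DecidableEq V] {G : Type*} [AddCommMonoid G] [PartialOrder G] [IsOrderedAddMonoid G]

open Classical in
theorem dimSum_nonneg_eq (r : V → V → ℕ) (v : Rˣ) (θ : (V →₀ ℕ) →+ G) (m : V →₀ ℕ) :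
    dimSum (arrowWeight r v) (fun m => 0 ≤ θ m) m =
      (multiFactorial m : ℚ) • ∑ p ∈ antidiagonal m with θ p.1 = 0,
        ((multiFactorial p.1 : ℚ)⁻¹ * (multiFactorial p.2 : ℚ)⁻¹) •
          (dimSum (arrowWeight r v) (fun m => 0 ≤ θ m) p.1 *
            dimSum (arrowWeight r v) (fun m => 0 < θ m) p.2 *
              ((v : R) ^ 2) ^ quiverForm r p.2 p.1) := by
  let lab (x : StdVertex m) : V := x.1
  have hweight (T T' : Finset (StdVertex m)) :
      ∏ p ∈ T ×ˢ T', (1 + arrowWeight r v (lab p.1) (lab p.2)) =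
        ((v : R) ^ 2) ^ quiverForm r (dimVec lab T) (dimVec lab T') := by
    rw [quiverForm_dimVec, ← Finset.prod_pow_eq_pow_sum]
    exact Finset.prod_congr rfl fun p _ => add_sub_cancel _ _
  have hsum := sum_powerset_dimVec lab Finset.univ fun m₁ m₂ => if θ m₁ = 0 then
    dimSum (arrowWeight r v) (fun m => 0 ≤ θ m) m₁ *
      dimSum (arrowWeight r v) (fun m => 0 < θ m) m₂ *
        ((v : R) ^ 2) ^ quiverForm r m₂ m₁ else 0
  rw [dimVec_stdVertex] at hsum
  simp only [Finset.sum_filter, ← smul_ite_zero]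
  rw [← hsum, dimSum]
  simp only [← relationSum_eq_dimSum, ← hweight, map_dimVec]
  rw [relationSum_nonneg_eq, Finset.sum_filter]

open Classical in
theorem hnCoeff_nonneg_eq (r : V → V → ℕ) (v u : Rˣ) (θ : (V →₀ ℕ) →+ G) (m : V →₀ ℕ) :
    hnCoeff r v u (fun m => 0 ≤ θ m) m = ∑ p ∈ antidiagonal m with θ p.1 = 0,
      ((v ^ quiverSkew r p.1 p.2 : Rˣ) : R) *
        (hnCoeff r v u (fun m => 0 ≤ θ m) p.1 * hnCoeff r v u (fun m => 0 < θ m) p.2) := by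
  rw [hnCoeff, dimSum_nonneg_eq, mul_smul_comm, smul_smul,
    inv_mul_cancel₀ (multiFactorial_ne_zero m), one_smul, Finset.mul_sum]
  refine Finset.sum_congr rfl fun p hp => ?_
  have hunit := congrArg Units.val (hnUnit_add r v u p.1 p.2)
  rw [mem_antidiagonal.1 (Finset.mem_filter.1 hp).1] at hunit
  push_cast at hunit
  rw [hnCoeff, hnCoeff, smul_mul_smul_comm, mul_smul_comm, mul_smul_comm]
  congr 1
  linear_combination dimSum (arrowWeight r v) (fun m => 0 ≤ θ m) p.1 *
    dimSum (arrowWeight r v) (fun m => 0 < θ m) p.2 * hunit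

open Classical in
/-- The generating series of the representations of `Q(m)`, where `θ m = 0`, which are semistable
with respect to `θ`. -/
noncomputable def hnFactor (r : V → V → ℕ) (v u : Rˣ) (θ : (V →₀ ℕ) →+ G) :
    QTorus v (quiverSkew r) :=
  ⟨fun m => if θ m = 0 then hnCoeff r v u (fun m => 0 ≤ θ m) m else 0⟩

theorem coeff_hnFactor_mul (r : V → V → ℕ) (v u : Rˣ) (θ : (V →₀ ℕ) →+ G)
    (A : QTorus v (quiverSkew r)) (m : V →₀ ℕ)
    (hA : ∀ m' ≤ m, A.coeff m' = hnCoeff r v u (fun m => 0 < θ m) m') :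
    (hnFactor r v u θ * A).coeff m = hnCoeff r v u (fun m => 0 ≤ θ m) m := by
  classical
  rw [hnCoeff_nonneg_eq, QTorus.coeff_mul, Finset.sum_filter]
  refine Finset.sum_congr rfl fun p hp => ?_
  rw [hA _ (le_of_le_of_eq le_add_self (mem_antidiagonal.1 hp)), hnFactor, ite_mul, zero_mul,
    mul_ite, mul_zero]

variable {ℓ : Type*}

theorem coeff_prod_hnFactor (r : V → V → ℕ) (v u : Rˣ) (θ : ℓ → (V →₀ ℕ) →+ G)
    (L : List ℓ) (m : V →₀ ℕ)
    (hord : L.Pairwise fun l l' => ∀ m' ≤ m, m' ≠ 0 → 0 ≤ θ l' m' → 0 < θ l m')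
    (hex : ∀ l ∈ L, ∀ m' ≤ m, m' ≠ 0 → 0 ≤ θ l m' → ∃ l' ∈ L, θ l' m' = 0) :
    (L.map fun l => hnFactor r v u (θ l)).prod.coeff m =
      hnCoeff r v u (fun m' => ∃ l ∈ L, θ l m' = 0) m := by
  induction L generalizing m with
  | nil =>
    simp only [List.map_nil, List.prod_nil, QTorus.coeff_one, List.not_mem_nil, false_and,
      exists_false]
    split_ifs with hm
    exacts [hm ▸ (hnCoeff_zero r v u _).symm, (hnCoeff_false r v u hm).symm]
  | cons l L ih =>
    rw [List.pairwise_cons] at hord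
    have hiff (m') (hm' : m' ≤ m) (h0 : m' ≠ 0) :=
      exists_mem_cons_iff_nonneg (x := fun l => θ l m') (fun l' hl' => hord.1 l' hl' m' hm' h0)
        (hex l List.mem_cons_self m' hm' h0)
    rw [hnCoeff_congr r v u fun m' hm' h0 => (hiff m' hm' h0).1, List.map_cons, List.prod_cons]
    refine coeff_hnFactor_mul r v u _ _ m fun m' hm' => ?_
    rw [ih m' (hord.2.imp fun h m'' hm'' => h m'' (hm''.trans hm')) fun l' hl' m'' hm'' h0 h =>
      (hiff m'' (hm''.trans hm') h0).2.2 (hord.1 l' hl' m'' (hm''.trans hm') h0 h)]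
    exact hnCoeff_congr r v u fun m'' hm'' h0 => (hiff m'' (hm''.trans hm') h0).2

theorem coeff_prod_hnFactor_eq_total (r : V → V → ℕ) (v u : Rˣ) (θ : ℓ → (V →₀ ℕ) →+ G)
    (L : List ℓ) (m : V →₀ ℕ)
    (hord : L.Pairwise fun l l' => ∀ m' ≤ m, m' ≠ 0 → 0 ≤ θ l' m' → 0 < θ l m')
    (hex : ∀ m' ≤ m, m' ≠ 0 → ∃ l ∈ L, θ l m' = 0) :
    (L.map fun l => hnFactor r v u (θ l)).prod.coeff m = hnCoeff r v u (fun _ => True) m := by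
  rw [coeff_prod_hnFactor r v u θ L m hord fun _ _ m' hm' h0 _ => hex m' hm' h0]
  exact hnCoeff_congr r v u fun m' hm' h0 => iff_of_true (hex m' hm' h0) trivial

end HarderNarasimhan

/-! ### Coefficients in quantum tori -/

namespace QTorus

section CanonicallyOrdered

variable {M R : Type*} [AddCommMonoid M] [PartialOrder M] [CanonicallyOrderedAdd M]
  [Finset.HasAntidiagonal M] [CommRing R] {v : Rˣ} {ω : M →+ M →+ ℤ}

theorem coeff_mul_zero (A B : QTorus v ω) : (A * B).coeff 0 = A.coeff 0 * B.coeff 0 := by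
  simp [coeff_mul]

theorem coeff_mul_congr {A A' B B' : QTorus v ω} {γ : M}
    (hA : ∀ δ ≤ γ, A.coeff δ = A'.coeff δ) (hB : ∀ δ ≤ γ, B.coeff δ = B'.coeff δ) :
    (A * B).coeff γ = (A' * B').coeff γ := by
  classical
  rw [coeff_mul, coeff_mul]
  refine Finset.sum_congr rfl fun p hp => ?_
  rw [mem_antidiagonal] at hp
  rw [hA p.1 (hp ▸ le_self_add), hB p.2 (hp ▸ le_add_self)]

theorem coeff_mul_sub_coeff_mul [IsCancelAdd M] {A A' B B' : QTorus v ω} {γ : M} (hγ : γ ≠ 0)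
    (hA : ∀ δ < γ, A.coeff δ = A'.coeff δ) (hB : ∀ δ < γ, B.coeff δ = B'.coeff δ) :
    (A * B).coeff γ - (A' * B').coeff γ =
      (A.coeff γ - A'.coeff γ) * B.coeff 0 + A.coeff 0 * (B.coeff γ - B'.coeff γ) := by
  classical
  have h0 : 0 < γ := pos_iff_ne_zero.2 hγ
  rw [coeff_mul, coeff_mul, ← Finset.sum_sub_distrib,
    Finset.sum_eq_add (γ, 0) (0, γ) (fun h => hγ (Prod.mk.inj h).1)]
  · simp only [map_zero, AddMonoidHom.zero_apply, zpow_zero, Units.val_one, one_mul]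
    rw [← hA 0 h0, ← hB 0 h0]
    ring
  · rintro ⟨x, y⟩ hp ⟨hne, hne'⟩
    obtain rfl : x + y = γ := mem_antidiagonal.1 hp
    have hx : x < x + y := le_self_add.lt_of_ne fun h => hne <| by
      rw [left_eq_add.1 h, add_zero]
    have hy : y < x + y := le_add_self.lt_of_ne fun h => hne' <| by
      rw [right_eq_add.1 h, zero_add]
    rw [hA x hx, hB y hy, sub_self]
  · simp
  · simp

variable [DecidableEq M]

theorem coeff_pow_congr {A A' : QTorus v ω} {γ : M}
    (h : ∀ δ ≤ γ, A.coeff δ = A'.coeff δ) (n : ℕ) : (A ^ n).coeff γ = (A' ^ n).coeff γ := by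
  induction n generalizing γ with
  | zero => rw [pow_zero, pow_zero]
  | succ n ih =>
    rw [pow_succ, pow_succ]
    exact coeff_mul_congr (fun δ hδ => ih fun ε hε => h ε (hε.trans hδ)) h

theorem coeff_exp_congr [Algebra ℚ R] {A A' : QTorus v ω} {γ : M}
    (h : ∀ δ ≤ γ, A.coeff δ = A'.coeff δ) : (exp A).coeff γ = (exp A').coeff γ :=
  finsum_congr fun n => by rw [coeff_pow_congr h]

theorem coeff_list_prod_zero {ι : Type*} (F : ι → QTorus v ω) (hF : ∀ i, (F i).coeff 0 = 1)
    (L : List ι) : (L.map F).prod.coeff 0 = 1 := by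
  induction L with
  | nil => simp [coeff_one]
  | cons i L ih => rw [List.map_cons, List.prod_cons, coeff_mul_zero, hF, ih, one_mul]

theorem coeff_list_prod_congr {ι : Type*} {F F' : ι → QTorus v ω} {γ : M}
    (h : ∀ i, ∀ δ ≤ γ, (F i).coeff δ = (F' i).coeff δ) (L : List ι) :
    (L.map F).prod.coeff γ = (L.map F').prod.coeff γ := by
  induction L generalizing γ with
  | nil => rfl
  | cons i L ih =>
    rw [List.map_cons, List.prod_cons, List.map_cons, List.prod_cons]
    exact coeff_mul_congr (h i) fun δ hδ => ih fun j ε hε => h j ε (hε.trans hδ)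

variable [IsCancelAdd M]

theorem coeff_list_prod_sub_coeff_list_prod {ι : Type*} {F F' : ι → QTorus v ω} {γ : M}
    (hγ : γ ≠ 0) (hF : ∀ i, (F i).coeff 0 = 1)
    (h : ∀ i, ∀ δ < γ, (F i).coeff δ = (F' i).coeff δ) (L : List ι) :
    (L.map F).prod.coeff γ - (L.map F').prod.coeff γ =
      (L.map fun i => (F i).coeff γ - (F' i).coeff γ).sum := by
  induction L with
  | nil => simp
  | cons i L ih =>
    rw [List.map_cons, List.prod_cons, List.map_cons, List.prod_cons, List.map_cons,
      List.sum_cons, ← ih, coeff_mul_sub_coeff_mul hγ (h i), hF, coeff_list_prod_zero F hF,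
      mul_one, one_mul]
    exact fun δ hδ => coeff_list_prod_congr (fun j ε hε => h j ε (hε.trans_lt hδ)) L

theorem coeff_pow_eq_of_forall_lt {A A' : QTorus v ω} (hA : A.coeff 0 = 0) {γ : M} (hγ : γ ≠ 0)
    (h : ∀ δ < γ, A.coeff δ = A'.coeff δ) {n : ℕ} (hn : 2 ≤ n) :
    (A ^ n).coeff γ = (A' ^ n).coeff γ := by
  obtain ⟨n, rfl⟩ := Nat.exists_eq_add_of_le' hn
  have hpow : (A ^ (n + 1)).coeff 0 = 0 := by rw [pow_succ, coeff_mul_zero, hA, mul_zero]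
  rw [pow_succ, pow_succ A', ← sub_eq_zero, coeff_mul_sub_coeff_mul hγ
    (fun δ hδ => coeff_pow_congr (fun ε hε => h ε (hε.trans_lt hδ)) _) h, hA, hpow, mul_zero,
    zero_mul, add_zero]

end CanonicallyOrdered

section Finsupp

variable {σ R : Type*} [DecidableEq σ] [CommRing R] {v : Rˣ} {ω : (σ →₀ ℕ) →+ (σ →₀ ℕ) →+ ℤ}

theorem coeff_pow_eq_zero {A : QTorus v ω} (hA : A.coeff 0 = 0) {n : ℕ} {γ : σ →₀ ℕ}
    (h : γ.degree < n) : (A ^ n).coeff γ = 0 := by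
  induction n generalizing γ with
  | zero => exact (Nat.not_lt_zero _ h).elim
  | succ n ih =>
    rw [pow_succ, coeff_mul]
    refine Finset.sum_eq_zero fun p hp => ?_
    by_cases hp2 : p.2 = 0
    · rw [hp2, hA, mul_zero, mul_zero]
    · have := (Finsupp.degree_eq_zero_iff p.2).not.2 hp2
      rw [← mem_antidiagonal.1 hp, map_add] at h
      rw [ih (by omega), zero_mul, mul_zero]

variable [Algebra ℚ R]

theorem coeff_exp {A : QTorus v ω} (hA : A.coeff 0 = 0) {γ : σ →₀ ℕ} {N : ℕ}
    (hN : γ.degree < N) :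
    (exp A).coeff γ = ∑ n ∈ Finset.range N, (n.factorial : ℚ)⁻¹ • (A ^ n).coeff γ := by
  refine finsum_eq_sum_of_support_subset _ fun n hn => ?_
  rw [Finset.coe_range, Set.mem_Iio]
  by_contra! hle
  exact hn (smul_eq_zero_of_right _ (coeff_pow_eq_zero hA (hN.trans_le hle)))

theorem coeff_exp_zero {A : QTorus v ω} (hA : A.coeff 0 = 0) : (exp A).coeff 0 = 1 := by
  rw [coeff_exp hA (N := 1) (by rw [map_zero]; exact one_pos)]
  simp [coeff_one]

theorem coeff_exp_sub_coeff_exp {A A' : QTorus v ω} (hA : A.coeff 0 = 0) {γ : σ →₀ ℕ}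
    (hγ : γ ≠ 0) (h : ∀ δ < γ, A.coeff δ = A'.coeff δ) :
    (exp A).coeff γ - (exp A').coeff γ = A.coeff γ - A'.coeff γ := by
  have hA' : A'.coeff 0 = 0 := (h 0 (pos_iff_ne_zero.2 hγ)).symm.trans hA
  have hN : γ.degree < γ.degree + 2 := by omega
  rw [coeff_exp hA hN, coeff_exp hA' hN, ← Finset.sum_sub_distrib, Finset.sum_eq_single 1]
  · simp
  · intro n _ hn
    obtain rfl | h2 : n = 0 ∨ 2 ≤ n := by omega
    · simp
    · rw [coeff_pow_eq_of_forall_lt hA hγ h h2, sub_self]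
  · simp

end Finsupp

end QTorus

/-! ### Monomial substitutions and sums of variables -/

namespace QTorus

theorem sum_fiber_antidiagonal {M N R : Type*} [AddCommMonoid M] [AddCommMonoid N]
    [Finset.HasAntidiagonal M] [Finset.HasAntidiagonal N] [AddCommMonoid R] (φ : M →+ N)
    (hφ : ∀ γ, {m | φ m = γ}.Finite) (f : M × M → R) (γ : N) :
    ∑ m ∈ (hφ γ).toFinset, ∑ p ∈ antidiagonal m, f p =
      ∑ q ∈ antidiagonal γ, ∑ p ∈ (hφ q.1).toFinset ×ˢ (hφ q.2).toFinset, f p := by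
  rw [Finset.sum_sigma', Finset.sum_sigma']
  refine Finset.sum_bij' (fun x _ => ⟨(φ x.2.1, φ x.2.2), x.2⟩)
    (fun y _ => ⟨y.2.1 + y.2.2, y.2⟩) ?_ ?_ ?_ ?_ fun _ _ => rfl
  · rintro ⟨m, p⟩ h
    simp only [Finset.mem_sigma, Set.Finite.mem_toFinset, Set.mem_ofPred_eq, mem_antidiagonal,
      Finset.mem_product, and_true] at h ⊢
    rw [← map_add, h.2, h.1]
  · rintro ⟨q, p⟩ h
    simp only [Finset.mem_sigma, Set.Finite.mem_toFinset, Set.mem_ofPred_eq, mem_antidiagonal,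
      Finset.mem_product, and_true] at h ⊢
    rw [map_add, h.2.1, h.2.2, h.1]
  · rintro ⟨m, p⟩ h
    simp only [Finset.mem_sigma, mem_antidiagonal] at h
    rw [h.2]
  · rintro ⟨q, p⟩ h
    simp only [Finset.mem_sigma, Set.Finite.mem_toFinset, Set.mem_ofPred_eq,
      Finset.mem_product] at h
    rw [h.2.1, h.2.2]

theorem eq_zero_of_finite_ker {M N : Type*} [AddMonoid M] [IsCancelAdd M] [IsAddTorsionFree M]
    [AddMonoid N] {φ : M →+ N} (hφ : {m | φ m = 0}.Finite) {m : M} (hm : φ m = 0) : m = 0 := by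
  by_contra h0
  refine Set.infinite_of_injective_forall_mem (f := fun n : ℕ => n • m)
    ((IsAddLeftRegular.all m).nsmul_injective h0) (fun n => ?_) hφ
  rw [Set.mem_ofPred_eq, map_nsmul, hm, smul_zero]

section Substitution

variable {σ τ R : Type*} [DecidableEq σ] [DecidableEq τ] [CommRing R] {v : Rˣ}
  {ω : (τ →₀ ℕ) →+ (τ →₀ ℕ) →+ ℤ} {ω' : (σ →₀ ℕ) →+ (σ →₀ ℕ) →+ ℤ}
  {φ : (σ →₀ ℕ) →+ (τ →₀ ℕ)}

/-- The homomorphism of quantum tori which maps the monomial `x^m` to `a^m x^(φ m)`, where `φ` is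
compatible with the forms. The finiteness of the fibres of `φ` makes it act on formal series. -/
noncomputable def substitution (hφ : ∀ γ, {m | φ m = γ}.Finite)
    (hω : ∀ m m', ω' m m' = ω (φ m) (φ m')) (a : σ → R) : QTorus v ω' →+* QTorus v ω where
  toFun A := ⟨fun γ => ∑ m ∈ (hφ γ).toFinset, A.coeff m * m.prod fun i k => a i ^ k⟩
  map_zero' := by ext; simp
  map_add' A B := by ext; simp [add_mul, Finset.sum_add_distrib]
  map_one' := by ext; simp [coeff_one, eq_comm]
  map_mul' A B := by
    ext γ
    have hterm (m : σ →₀ ℕ) : (A * B).coeff m * (m.prod fun i k => a i ^ k) =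
        ∑ p ∈ antidiagonal m, ((v ^ ω (φ p.1) (φ p.2) : Rˣ) : R) *
          ((A.coeff p.1 * p.1.prod fun i k => a i ^ k) *
            (B.coeff p.2 * p.2.prod fun i k => a i ^ k)) := by
      rw [coeff_mul, Finset.sum_mul]
      refine Finset.sum_congr rfl fun p hp => ?_
      rw [← mem_antidiagonal.1 hp, Finsupp.prod_add_index' (fun _ => pow_zero _)
        (fun _ _ _ => pow_add _ _ _), hω]
      ring
    refine (Finset.sum_congr rfl fun m _ => hterm m).trans ?_
    rw [sum_fiber_antidiagonal φ hφ, coeff_mul]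
    refine Finset.sum_congr rfl fun q _ => ?_
    rw [Finset.sum_mul_sum, ← Finset.sum_product', Finset.mul_sum]
    refine Finset.sum_congr rfl fun p hp => ?_
    rw [Finset.mem_product, Set.Finite.mem_toFinset, Set.Finite.mem_toFinset] at hp
    rw [← hp.1, ← hp.2]

variable (hφ : ∀ γ, {m | φ m = γ}.Finite) (hω : ∀ m m', ω' m m' = ω (φ m) (φ m')) (a : σ → R)

theorem coeff_substitution (A : QTorus v ω') (γ : τ →₀ ℕ) :
    (substitution hφ hω a A).coeff γ =
      ∑ m ∈ (hφ γ).toFinset, A.coeff m * m.prod fun i k => a i ^ k := rfl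

theorem coeff_substitution_zero (A : QTorus v ω') :
    (substitution hφ hω a A).coeff 0 = A.coeff 0 := by
  have hker : (hφ 0).toFinset = {0} := by
    ext m
    rw [Set.Finite.mem_toFinset, Finset.mem_singleton]
    exact ⟨eq_zero_of_finite_ker (hφ 0), fun h => h ▸ map_zero φ⟩
  rw [coeff_substitution, hker, Finset.sum_singleton, Finsupp.prod_zero_index, mul_one]

theorem substitution_exp [Algebra ℚ R] {A : QTorus v ω'} (hA : A.coeff 0 = 0) :
    substitution hφ hω a (exp A) = exp (substitution hφ hω a A) := by
  ext γ
  let N := max γ.degree ((hφ γ).toFinset.sup Finsupp.degree) + 1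
  rw [coeff_exp ((coeff_substitution_zero hφ hω a A).trans hA)
    (Nat.lt_succ_of_le (le_max_left _ _) : γ.degree < N), coeff_substitution]
  simp only [← map_pow, coeff_substitution, Finset.smul_sum]
  rw [Finset.sum_comm]
  refine Finset.sum_congr rfl fun m hm => ?_
  rw [coeff_exp hA (Nat.lt_succ_of_le (le_max_of_le_right (Finset.le_sup hm)) : m.degree < N),
    Finset.sum_mul]
  exact Finset.sum_congr rfl fun n _ => smul_mul_assoc _ _ _

end Substitution

section VertexSum

variable {V R : Type*} [CommRing R] {v : Rˣ} {ω : (V →₀ ℕ) →+ (V →₀ ℕ) →+ ℤ}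

open Classical in
/-- The series `∑ c x_i`, where the sum is over the vertices `i` with the property `S`. -/
noncomputable def vertexSum (v : Rˣ) (ω : (V →₀ ℕ) →+ (V →₀ ℕ) →+ ℤ) (S : V → Prop) (c : R) :
    QTorus v ω :=
  ⟨fun m => if ∃ i, S i ∧ m = Finsupp.single i 1 then c else 0⟩

theorem coeff_vertexSum_zero (S : V → Prop) (c : R) : (vertexSum v ω S c).coeff 0 = 0 :=
  if_neg fun ⟨_, _, h⟩ => Finsupp.single_ne_zero.2 one_ne_zero h.symm

open Classical in
theorem coeff_vertexSum_single (S : V → Prop) (c : R) (i : V) :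
    (vertexSum v ω S c).coeff (Finsupp.single i 1) = if S i then c else 0 := by
  refine if_congr ⟨?_, fun h => ⟨i, h, rfl⟩⟩ rfl rfl
  rintro ⟨j, hj, hij⟩
  exact Finsupp.single_left_injective one_ne_zero hij ▸ hj

theorem coeff_vertexSum_eq_zero (S : V → Prop) (c : R) {m : V →₀ ℕ}
    (hm : ∀ i, m ≠ Finsupp.single i 1) : (vertexSum v ω S c).coeff m = 0 :=
  if_neg fun ⟨i, _, hi⟩ => hm i hi

open Classical in
theorem coeff_vertexSum_mul [DecidableEq V] (S : V → Prop) (c : R) (B : QTorus v ω) (m : V →₀ ℕ) :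
    (vertexSum v ω S c * B).coeff m = ∑ i ∈ m.support, if S i then
      ((v ^ ω (Finsupp.single i 1) (m - Finsupp.single i 1) : Rˣ) : R) *
        (c * B.coeff (m - Finsupp.single i 1)) else 0 := by
  rw [coeff_mul]
  refine (Finset.sum_of_injOn (fun i => (Finsupp.single i 1, m - Finsupp.single i 1)) ?_ ?_ ?_
    fun i _ => ?_).symm
  · exact fun i _ j _ h => Finsupp.single_left_injective one_ne_zero (Prod.mk.inj h).1
  · intro i hi
    exact mem_antidiagonal.2 (add_tsub_cancel_of_le
      (Finsupp.single_le_iff.2 (Nat.one_le_iff_ne_zero.2 (Finsupp.mem_support_iff.1 hi))))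
  · intro p hp hne
    rw [coeff_vertexSum_eq_zero, zero_mul, mul_zero]
    intro i hi
    obtain rfl := mem_antidiagonal.1 hp
    refine hne ⟨i, ?_, Prod.ext hi.symm ?_⟩
    · simp [hi]
    · dsimp only
      rw [hi, add_tsub_cancel_left]
  · rw [coeff_vertexSum_single, ite_mul, zero_mul, mul_ite, mul_zero]

theorem degree_eq_of_coeff_vertexSum_pow_ne_zero [DecidableEq V] {S : V → Prop} {c : R} {n : ℕ}
    {m : V →₀ ℕ} (h : (vertexSum v ω S c ^ n).coeff m ≠ 0) :
    m.degree = n ∧ ∀ i ∈ m.support, S i := by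
  classical
  induction n generalizing m with
  | zero =>
    obtain rfl : m = 0 := by
      by_contra hm
      exact h (by rw [pow_zero, coeff_one, if_neg hm])
    simp
  | succ n ih =>
    rw [pow_succ', coeff_vertexSum_mul] at h
    obtain ⟨i, hi, hne⟩ := Finset.exists_ne_zero_of_sum_ne_zero h
    obtain ⟨hSi, hne⟩ := ite_ne_right_iff.1 hne
    obtain ⟨hdeg, hS⟩ := ih (right_ne_zero_of_mul (right_ne_zero_of_mul hne))
    rw [← Finsupp.sub_add_single_one_cancel (Finsupp.mem_support_iff.1 hi)]
    refine ⟨by rw [map_add, hdeg, Finsupp.degree_single], fun j hj => ?_⟩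
    rcases Finset.mem_union.1 (Finsupp.support_add hj) with hj | hj
    · exact hS j hj
    · rwa [Finset.mem_singleton.1 (Finsupp.support_single_subset hj)]

open Classical in
theorem coeff_vertexSum_pow_degree [DecidableEq V] [Algebra ℚ R] {S : V → Prop} (c : R)
    (hω : ∀ i m, S i → (∀ j ∈ m.support, S j) → ω (Finsupp.single i 1) m = 0) {m : V →₀ ℕ}
    (hm : ∀ i ∈ m.support, S i) :
    (vertexSum v ω S c ^ m.degree).coeff m =
      ((m.degree.factorial : ℚ) * (multiFactorial m : ℚ)⁻¹) • c ^ m.degree := by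
  induction hn : m.degree generalizing m with
  | zero =>
    rw [(Finsupp.degree_eq_zero_iff m).1 hn]
    simp [coeff_one, multiFactorial_zero]
  | succ n ih =>
    have hterm : ∀ i ∈ m.support, (if S i then
        ((v ^ ω (Finsupp.single i 1) (m - Finsupp.single i 1) : Rˣ) : R) *
          (c * (vertexSum v ω S c ^ n).coeff (m - Finsupp.single i 1)) else 0) =
        ((m i : ℚ) * ((n.factorial : ℚ) * (multiFactorial m : ℚ)⁻¹)) • c ^ (n + 1) := by
      intro i hi
      obtain ⟨m', rfl⟩ : ∃ m', m = m' + Finsupp.single i 1 :=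
        ⟨_, (Finsupp.sub_add_single_one_cancel (Finsupp.mem_support_iff.1 hi)).symm⟩
      have hm' : ∀ j ∈ m'.support, S j := fun j hj =>
        hm j (Finsupp.support_mono le_self_add hj)
      have hdeg : m'.degree = n := by
        rw [map_add, Finsupp.degree_single] at hn
        exact Nat.succ_injective hn
      rw [if_pos (hm i hi), add_tsub_cancel_right, hω i m' (hm i hi) hm', zpow_zero,
        Units.val_one, one_mul, ih hm' hdeg, mul_smul_comm, ← pow_succ',
        ← add_one_mul_inv_multiFactorial m' i, mul_left_comm]
      simp
    rw [pow_succ', coeff_vertexSum_mul, Finset.sum_congr rfl hterm, ← Finset.sum_smul,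
      ← Finset.sum_mul, ← Nat.cast_sum, ← Finsupp.degree_apply, hn, Nat.factorial_succ,
      Nat.cast_mul, mul_assoc]

open Classical in
theorem coeff_exp_vertexSum [DecidableEq V] [Algebra ℚ R] (S : V → Prop) (c : R)
    (hω : ∀ i m, S i → (∀ j ∈ m.support, S j) → ω (Finsupp.single i 1) m = 0) (m : V →₀ ℕ) :
    (exp (vertexSum v ω S c)).coeff m =
      if ∀ i ∈ m.support, S i then (multiFactorial m : ℚ)⁻¹ • c ^ m.degree else 0 := by
  rw [coeff_exp (coeff_vertexSum_zero S c) m.degree.lt_succ_self, Finset.sum_eq_single m.degree]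
  · split_ifs with hm
    · rw [coeff_vertexSum_pow_degree c hω hm, smul_smul,
        inv_mul_cancel_left₀ (Nat.cast_ne_zero.2 m.degree.factorial_ne_zero)]
    · rw [not_ne_iff.1 fun h => hm (degree_eq_of_coeff_vertexSum_pow_ne_zero h).2, smul_zero]
  · intro n _ hn
    rw [not_ne_iff.1 fun h => hn (degree_eq_of_coeff_vertexSum_pow_ne_zero h).1.symm, smul_zero]
  · exact fun h => (h (Finset.self_mem_range_succ _)).elim

end VertexSum

end QTorus

/-! ### Norms of dimension vectors -/

theorem mnorm_zero : mnorm 0 = 0 := Finsupp.sum_zero_index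

theorem mnorm_add (m m' : GStar →₀ ℕ) : mnorm (m + m') = mnorm m + mnorm m' :=
  Finsupp.sum_add_index' (fun _ => zero_smul _ _) fun _ _ _ => add_smul _ _ _

theorem mnorm_single (α : GStar) (k : ℕ) : mnorm (Finsupp.single α k) = k • α.1 :=
  Finsupp.sum_single_index (zero_smul _ _)

/-- The map `m ↦ ‖m‖` as a homomorphism, along which monomials of the quantum torus of `Q̂` are
substituted. -/
noncomputable def mnormHom : (GStar →₀ ℕ) →+ GPlus := ⟨⟨mnorm, mnorm_zero⟩, mnorm_add⟩

theorem mnormHom_apply (m : GStar →₀ ℕ) : mnormHom m = mnorm m := rfl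

theorem degree_le_degree_mnorm (m : GStar →₀ ℕ) : m.degree ≤ (mnorm m).degree := by
  induction m using Finsupp.induction_linear with
  | zero => simp
  | add m m' h h' =>
    rw [mnorm_add, map_add, map_add]
    exact add_le_add h h'
  | single α k =>
    rw [mnorm_single, map_nsmul, Finsupp.degree_single, smul_eq_mul]
    exact Nat.le_mul_of_pos_right _ (Nat.pos_of_ne_zero ((Finsupp.degree_eq_zero_iff _).not.2 α.2))

theorem finite_mnormHom_eq (γ : GPlus) : {m | mnormHom m = γ}.Finite := by
  have hS : {α : GStar | α.1 ≤ γ}.Finite :=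
    (Set.finite_Iic γ).preimage Subtype.val_injective.injOn
  refine (Set.finite_Iic (∑ α ∈ hS.toFinset, Finsupp.single α γ.degree)).subset ?_
  rintro m rfl α
  by_cases hα : m α = 0
  · exact hα ▸ Nat.zero_le _
  have hle : α.1 ≤ mnorm m := by
    obtain ⟨m', rfl⟩ := exists_add_of_le
      (Finsupp.single_le_iff.2 (Nat.one_le_iff_ne_zero.2 hα) : Finsupp.single α 1 ≤ m)
    rw [mnorm_add, mnorm_single, one_smul]
    exact le_self_add
  have hsingle : Finsupp.single α (mnorm m).degree ≤
      ∑ β ∈ hS.toFinset, Finsupp.single β (mnorm m).degree :=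
    Finset.single_le_sum (f := fun β => Finsupp.single β (mnorm m).degree)
      (fun _ _ => zero_le) (hS.mem_toFinset.2 hle)
  calc m α ≤ m.degree := Finsupp.le_degree α m
    _ ≤ (mnorm m).degree := degree_le_degree_mnorm m
    _ = Finsupp.single α (mnorm m).degree α := Finsupp.single_eq_same.symm
    _ ≤ _ := hsingle α

/-! ### Rays -/

/-- The cross product of `γ` with the ray `l`. It is positive, zero or negative if the slope of `γ`
is smaller than, equal to or larger than the slope of `l`. -/
noncomputable def rayCross (l : Ray) : GPlus →+ ℤ where
  toFun γ := (γ 0 : ℤ) * l.1 1 - (γ 1 : ℤ) * l.1 0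
  map_zero' := by simp
  map_add' γ δ := by simp only [Finsupp.add_apply]; push_cast; ring

theorem rayCross_apply (l : Ray) (γ : GPlus) :
    rayCross l γ = (γ 0 : ℤ) * l.1 1 - (γ 1 : ℤ) * l.1 0 := rfl

theorem rayCross_self (l : Ray) : rayCross l l.1 = 0 := by
  rw [rayCross_apply, mul_comm, sub_self]

theorem gplus_ext {γ δ : GPlus} (h0 : γ 0 = δ 0) (h1 : γ 1 = δ 1) : γ = δ :=
  Finsupp.ext (Fin.forall_fin_two.2 ⟨h0, h1⟩)

theorem gplus_ne_zero {γ : GPlus} : γ ≠ 0 ↔ γ 0 ≠ 0 ∨ γ 1 ≠ 0 := by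
  rw [← not_and_or, not_iff_not]
  exact ⟨fun h => by simp [h], fun h => gplus_ext h.1 h.2⟩

theorem Ray.coe_ne_zero (l : Ray) : l.1 ≠ 0 := fun h => by
  simpa [h] using l.2

theorem Ray.Mem.ne_zero {l : Ray} {γ : GPlus} (h : l.Mem γ) : γ ≠ 0 := by
  obtain ⟨n, hn, rfl⟩ := h
  exact smul_ne_zero hn.ne' l.coe_ne_zero

theorem Ray.Mem.rayCross_eq_zero {l : Ray} {γ : GPlus} (h : l.Mem γ) : rayCross l γ = 0 := by
  obtain ⟨n, -, rfl⟩ := h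
  rw [map_nsmul, rayCross_self, smul_zero]

theorem Ray.eq_of_rayCross_eq_zero {l l' : Ray} (h : rayCross l l'.1 = 0) : l' = l := by
  have hcross : l'.1 0 * l.1 1 = l'.1 1 * l.1 0 := by
    rw [rayCross_apply, sub_eq_zero] at h
    exact_mod_cast h
  refine Subtype.ext (gplus_ext (Nat.dvd_antisymm ?_ ?_) (Nat.dvd_antisymm ?_ ?_))
  · exact Nat.Coprime.dvd_of_dvd_mul_left l'.2 (hcross ▸ dvd_mul_right _ _)
  · exact Nat.Coprime.dvd_of_dvd_mul_right l.2 (hcross ▸ dvd_mul_left _ _)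
  · exact Nat.Coprime.dvd_of_dvd_mul_left (Nat.Coprime.symm l'.2) (hcross ▸ dvd_mul_right _ _)
  · exact Nat.Coprime.dvd_of_dvd_mul_right (Nat.Coprime.symm l.2) (hcross ▸ dvd_mul_left _ _)

theorem Ray.eq_of_mem {l l' : Ray} {γ : GPlus} (h : l.Mem γ) (h' : l'.Mem γ) : l = l' := by
  obtain ⟨n, hn, rfl⟩ := h
  have hcross := h'.rayCross_eq_zero
  rw [map_nsmul] at hcross
  exact Ray.eq_of_rayCross_eq_zero ((smul_eq_zero.1 hcross).resolve_left hn.ne')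

theorem exists_ray {γ : GPlus} (hγ : γ ≠ 0) : ∃ l : Ray, l.Mem γ := by
  have hg : 0 < Nat.gcd (γ 0) (γ 1) :=
    (gplus_ne_zero.1 hγ).elim (fun h => Nat.gcd_pos_of_pos_left _ (Nat.pos_of_ne_zero h))
      fun h => Nat.gcd_pos_of_pos_right _ (Nat.pos_of_ne_zero h)
  refine ⟨⟨Finsupp.equivFunOnFinite.symm ![γ 0 / Nat.gcd (γ 0) (γ 1), γ 1 / Nat.gcd (γ 0) (γ 1)],
    Nat.coprime_div_gcd_div_gcd hg⟩, Nat.gcd (γ 0) (γ 1), hg, gplus_ext ?_ ?_⟩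
  · simp [Nat.mul_div_cancel' (Nat.gcd_dvd_left (γ 0) (γ 1))]
  · simp [Nat.mul_div_cancel' (Nat.gcd_dvd_right (γ 0) (γ 1))]

theorem rayCross_eq_zero_iff {l : Ray} {γ : GPlus} (hγ : γ ≠ 0) :
    rayCross l γ = 0 ↔ l.Mem γ := by
  refine ⟨fun h => ?_, fun h => h.rayCross_eq_zero⟩
  obtain ⟨l', n, hn, rfl⟩ := exists_ray hγ
  rw [map_nsmul] at h
  obtain rfl := Ray.eq_of_rayCross_eq_zero ((smul_eq_zero.1 h).resolve_left hn.ne')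
  exact ⟨n, hn, rfl⟩

theorem rayCross_pos_of_slopeLT {l l' : Ray} (h : l'.slopeLT l) {γ : GPlus} (hγ : γ ≠ 0)
    (h' : 0 ≤ rayCross l' γ) : 0 < rayCross l γ := by
  rw [rayCross_apply] at h' ⊢
  have hlt : (l'.1 1 : ℤ) * l.1 0 < l.1 1 * l'.1 0 := by exact_mod_cast h
  have hl' : (0 : ℤ) < l'.1 0 := Nat.cast_pos.2 <| Nat.pos_of_ne_zero fun h0 =>
    absurd h (by simp [Ray.slopeLT, h0])
  have hγ0 : (0 : ℤ) < γ 0 := by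
    refine Nat.cast_pos.2 (Nat.pos_of_ne_zero fun h0 => ?_)
    have hγ1 : (0 : ℤ) < γ 1 :=
      Nat.cast_pos.2 (Nat.pos_of_ne_zero ((gplus_ne_zero.1 hγ).resolve_left (not_not.2 h0)))
    rw [h0, Nat.cast_zero, zero_mul, zero_sub] at h'
    linarith [mul_pos hγ1 hl']
  refine pos_of_mul_pos_right (b := ((γ 0 : ℤ) * l.1 1 - γ 1 * l.1 0)) ?_ hl'.le
  calc (0 : ℤ) < γ 0 * (l.1 1 * l'.1 0 - l'.1 1 * l.1 0) := mul_pos hγ0 (sub_pos.2 hlt)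
    _ ≤ γ 0 * (l.1 1 * l'.1 0 - l'.1 1 * l.1 0) + l.1 0 * (γ 0 * l'.1 1 - γ 1 * l'.1 0) :=
      le_add_of_nonneg_right (mul_nonneg (Int.natCast_nonneg _) h')
    _ = l'.1 0 * (γ 0 * l.1 1 - γ 1 * l.1 0) := by ring

theorem rayCross_neg_of_slopeLT {l l' : Ray} (h : l.slopeLT l') {γ : GPlus} (hγ : γ ≠ 0)
    (h' : rayCross l' γ ≤ 0) : rayCross l γ < 0 :=
  lt_of_not_ge fun hcon => h'.not_gt (rayCross_pos_of_slopeLT h hγ hcon)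

instance : IsStrictTotalOrder Ray Ray.slopeLT where
  irrefl _ := lt_irrefl _
  trans l₁ l₂ l₃ h₁₂ h₂₃ := by
    have hpos := rayCross_pos_of_slopeLT h₂₃ l₁.coe_ne_zero
      (rayCross_pos_of_slopeLT h₁₂ l₁.coe_ne_zero (rayCross_self l₁).ge).le
    rw [rayCross_apply, sub_pos] at hpos
    rw [Ray.slopeLT]
    linarith
  trichotomous l l' h h' := by
    refine Ray.eq_of_rayCross_eq_zero ?_
    rw [Ray.slopeLT, not_lt] at h h'
    rw [rayCross_apply, sub_eq_zero]
    rw [mul_comm]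
    exact_mod_cast h.antisymm h'

instance : IsStrictTotalOrder Ray fun l l' => l'.slopeLT l :=
  inferInstanceAs (IsStrictTotalOrder Ray (Function.swap Ray.slopeLT))

theorem exists_pairwise_list {α : Type*} (r : α → α → Prop) [IsStrictTotalOrder α r]
    (S : Finset α) : ∃ L : List α, L.Pairwise r ∧ ∀ a ∈ S, a ∈ L := by
  classical
  let := linearOrderOfSTO r
  exact ⟨S.sort, S.sortedLT_sort.pairwise, fun a ha => (Finset.mem_sort _).2 ha⟩

/-! ### Uniqueness of the ordered factorization -/

theorem HasOrderedProd.unique {ω : GPlus →+ GPlus →+ ℤ} {before : Ray → Ray → Prop}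
    [IsStrictTotalOrder Ray before] {F : Ray → QTorus sqrtQ ω} {P P' : QTorus sqrtQ ω}
    (h : HasOrderedProd before F P) (h' : HasOrderedProd before F P') : P = P' := by
  classical
  ext γ
  obtain ⟨S, hS⟩ := h γ
  obtain ⟨S', hS'⟩ := h' γ
  obtain ⟨L, hL, hSL⟩ := exists_pairwise_list before (S ∪ S')
  rw [← hS L hL fun l hl => hSL l (Finset.mem_union_left _ hl),
    ← hS' L hL fun l hl => hSL l (Finset.mem_union_right _ hl)]

theorem gmVir_ne_zero : gmVir ≠ 0 := by
  intro h
  have hX : (RatFunc.X : RatFunc ℚ) * RatFunc.X = 1 :=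
    (congrArg (· * HalfField.t) (sub_eq_zero.1 h)).trans (inv_mul_cancel₀ HalfField.t_ne_zero)
  rw [← RatFunc.algebraMap_X, ← map_mul, ← map_one (algebraMap ℚ[X] (RatFunc ℚ))] at hX
  simpa using congrArg (Polynomial.eval 0) (RatFunc.algebraMap_injective ℚ hX)

section RayExp

variable (ω : GPlus →+ GPlus →+ ℤ)

open Classical in
/-- The logarithm `∑_{γ ∈ l} a_γ x^γ / (q^{1/2} - q^{-1/2})` of the factor of the ray `l`. -/
noncomputable def rayLog (a : GStar → MotV) (l : Ray) : QTorus sqrtQ ω :=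
  ⟨fun γ => if h : γ ≠ 0 ∧ l.Mem γ then gmVir⁻¹ • a ⟨γ, h.1⟩ else 0⟩

theorem exp_rayLog (a : GStar → MotV) (l : Ray) : QTorus.exp (rayLog ω a l) = rayExp ω a l := rfl

theorem coeff_rayLog_zero (a : GStar → MotV) (l : Ray) : (rayLog ω a l).coeff 0 = 0 := by
  simp [rayLog]

open Classical in
theorem coeff_rayLog (a : GStar → MotV) (l : Ray) (γ : GStar) :
    (rayLog ω a l).coeff γ.1 = if l.Mem γ.1 then gmVir⁻¹ • a γ else 0 := by
  simp only [rayLog, ne_eq, γ.2, not_false_eq_true, true_and, Subtype.coe_eta,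
    dite_eq_ite]

theorem coeff_rayLog_congr {a b : GStar → MotV} (l : Ray) {γ : GPlus}
    (h : ∀ hγ : γ ≠ 0, a ⟨γ, hγ⟩ = b ⟨γ, hγ⟩) :
    (rayLog ω a l).coeff γ = (rayLog ω b l).coeff γ := by
  simp only [rayLog, h]

theorem coeff_rayExp_zero (a : GStar → MotV) (l : Ray) : (rayExp ω a l).coeff 0 = 1 :=
  QTorus.coeff_exp_zero (coeff_rayLog_zero ω a l)

open Classical in
theorem coeff_rayExp_sub_coeff_rayExp {a b : GStar → MotV} (l : Ray) {γ : GStar}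
    (h : ∀ δ : GStar, δ.1 < γ.1 → a δ = b δ) :
    (rayExp ω a l).coeff γ.1 - (rayExp ω b l).coeff γ.1 =
      if l.Mem γ.1 then gmVir⁻¹ • (a γ - b γ) else 0 := by
  rw [← exp_rayLog, ← exp_rayLog, QTorus.coeff_exp_sub_coeff_exp (coeff_rayLog_zero ω a l) γ.2
    fun δ hδ => coeff_rayLog_congr ω l fun hδ0 => h ⟨δ, hδ0⟩ hδ, coeff_rayLog, coeff_rayLog]
  split_ifs
  · exact (smul_sub _ _ _).symm
  · exact sub_zero 0

theorem coeff_rayExp_congr {a b : GStar → MotV} (l : Ray) {γ : GPlus}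
    (h : ∀ δ : GStar, δ.1 ≤ γ → a δ = b δ) :
    (rayExp ω a l).coeff γ = (rayExp ω b l).coeff γ :=
  QTorus.coeff_exp_congr fun δ hδ => coeff_rayLog_congr ω l fun hδ0 => h ⟨δ, hδ0⟩ hδ

variable {ω} {before : Ray → Ray → Prop} [IsStrictTotalOrder Ray before] {a b : GStar → MotV}
  {P : QTorus sqrtQ ω}

theorem HasOrderedProd.rayExp_apply_eq_of_forall_lt (ha : HasOrderedProd before (rayExp ω a) P)
    (hb : HasOrderedProd before (rayExp ω b) P) {γ : GStar}
    (h : ∀ δ : GStar, δ.1 < γ.1 → a δ = b δ) : a γ = b γ := by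
  classical
  obtain ⟨S, hS⟩ := ha γ.1
  obtain ⟨S', hS'⟩ := hb γ.1
  obtain ⟨l, hl⟩ := exists_ray γ.2
  obtain ⟨L, hL, hSL⟩ := exists_pairwise_list before (insert l (S ∪ S'))
  have hdiff : (0 : MotV) =
      (L.map fun l' => if l'.Mem γ.1 then gmVir⁻¹ • (a γ - b γ) else 0).sum := by
    simp only [← coeff_rayExp_sub_coeff_rayExp ω _ h]
    rw [← QTorus.coeff_list_prod_sub_coeff_list_prod γ.2 (coeff_rayExp_zero ω a)
      (fun l δ hδ => coeff_rayExp_congr ω l fun ε hε => h ε (hε.trans_lt hδ)) L,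
      hS L hL fun l hl => hSL l (by simp [hl]), hS' L hL fun l hl => hSL l (by simp [hl]), sub_self]
  have hmem (l' : Ray) : l'.Mem γ.1 ↔ l' = l := ⟨fun h' => Ray.eq_of_mem h' hl, fun h' => h' ▸ hl⟩
  have hnodup : L.Nodup := hL.imp fun hxy => ne_of_irrefl hxy
  simp only [hmem] at hdiff
  rw [← List.sum_toFinset _ hnodup, Finset.sum_ite_eq',
    if_pos (List.mem_toFinset.2 (hSL l (Finset.mem_insert_self _ _)))] at hdiff
  exact sub_eq_zero.1 ((smul_eq_zero.1 hdiff.symm).resolve_left (inv_ne_zero gmVir_ne_zero))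

theorem rayExp_factorization_unique (ha : HasOrderedProd before (rayExp ω a) P)
    (hb : HasOrderedProd before (rayExp ω b) P) : a = b :=
  funext fun γ => WellFoundedLT.induction (motive := fun γ : GStar => a γ = b γ) γ fun _ ih =>
    ha.rayExp_apply_eq_of_forall_lt hb ih

end RayExp

/-! ### Slopes and crossings of rays -/

theorem HPlus.add {z w : ℂ} (hz : HPlus z) (hw : HPlus w) : HPlus (z + w) := by
  rw [HPlus, Complex.add_im, Complex.add_re]
  rcases hz with h | ⟨h, h'⟩ <;> rcases hw with k | ⟨k, k'⟩
  · exact Or.inl (add_pos h k)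
  · exact Or.inl (k.symm ▸ (add_zero z.im).symm ▸ h)
  · exact Or.inl (h.symm ▸ (zero_add w.im).symm ▸ k)
  · exact Or.inr ⟨by rw [h, k, add_zero], add_neg h' k'⟩

theorem HPlus.nsmul {z : ℂ} (hz : HPlus z) {n : ℕ} (hn : n ≠ 0) : HPlus (n • z) := by
  induction n with
  | zero => exact absurd rfl hn
  | succ n ih =>
    rcases eq_or_ne n 0 with rfl | hn
    · rwa [zero_add, one_smul]
    · exact succ_nsmul z n ▸ (ih hn).add hz

theorem hPlus_map {σ : Type*} {Z : (σ →₀ ℕ) →+ ℂ} (hZ : ∀ i, HPlus (Z (Finsupp.single i 1)))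
    {γ : σ →₀ ℕ} (hγ : γ ≠ 0) : HPlus (Z γ) := by
  suffices γ = 0 ∨ HPlus (Z γ) from this.resolve_left hγ
  clear hγ
  induction γ using Finsupp.induction_linear with
  | zero => exact Or.inl rfl
  | add γ δ hγ hδ =>
    rcases hγ with rfl | hγ
    · rwa [zero_add]
    rcases hδ with rfl | hδ
    · exact Or.inr (by rwa [add_zero])
    · exact Or.inr (map_add Z γ δ ▸ hγ.add hδ)
  | single i n =>
    rcases eq_or_ne n 0 with rfl | hn
    · exact Or.inl (Finsupp.single_zero i)
    · rw [← Finsupp.smul_single_one, map_nsmul]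
      exact Or.inr ((hZ i).nsmul hn)

theorem zslope_le_iff {z w : ℂ} (hz : HPlus z) (hw : HPlus w) :
    zslope z ≤ zslope w ↔ w.re * z.im ≤ z.re * w.im := by
  unfold zslope
  rcases hz with h | ⟨h, h'⟩ <;> rcases hw with k | ⟨k, k'⟩
  · rw [if_neg h.ne', if_neg k.ne', WithTop.coe_le_coe, div_le_div_iff₀ h k, neg_mul, neg_mul,
      neg_le_neg_iff]
  · rw [if_pos k, k, mul_zero]
    exact iff_of_true le_top (mul_nonpos_of_nonpos_of_nonneg k'.le h.le)
  · rw [if_pos h, if_neg k.ne', h, mul_zero]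
    exact iff_of_false (by simp) (mul_neg_of_neg_of_pos h' k).not_ge
  · simp [h, k]

theorem map_eq_smul_add_smul {A : Type*} [AddCommMonoid A] (f : GPlus →+ A) (γ : GPlus) :
    f γ = γ 0 • f (Finsupp.single 0 1) + γ 1 • f (Finsupp.single 1 1) := by
  rw [← map_nsmul, ← map_nsmul, ← map_add]
  exact congrArg f (gplus_ext (by simp) (by simp))

theorem re_mul_im_sub_re_mul_im (Z : GPlus →+ ℂ) (γ δ : GPlus) :
    (Z γ).re * (Z δ).im - (Z δ).re * (Z γ).im =
      ((Z (Finsupp.single 0 1)).re * (Z (Finsupp.single 1 1)).im -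
        (Z (Finsupp.single 1 1)).re * (Z (Finsupp.single 0 1)).im) *
        ((γ 0 : ℝ) * δ 1 - γ 1 * δ 0) := by
  rw [map_eq_smul_add_smul Z γ, map_eq_smul_add_smul Z δ]
  simp only [nsmul_eq_mul, Complex.add_re, Complex.add_im, Complex.mul_re, Complex.mul_im,
    Complex.natCast_re, Complex.natCast_im, zero_mul, sub_zero, add_zero]
  ring

theorem zslope_map_le_iff {Z : GPlus →+ ℂ} (hZ : ∀ i, HPlus (Z (Finsupp.single i 1)))
    (hlt : zslope (Z (Finsupp.single 0 1)) < zslope (Z (Finsupp.single 1 1)))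
    {γ δ : GPlus} (hγ : γ ≠ 0) {l : Ray} (hδ : l.Mem δ) :
    zslope (Z γ) ≤ zslope (Z δ) ↔ 0 ≤ rayCross l γ := by
  rw [← not_le, zslope_le_iff (hZ 1) (hZ 0), not_le, ← sub_pos] at hlt
  rw [zslope_le_iff (hPlus_map hZ hγ) (hPlus_map hZ hδ.ne_zero), ← sub_nonneg,
    re_mul_im_sub_re_mul_im, mul_nonneg_iff_of_pos_left hlt]
  obtain ⟨n, hn, rfl⟩ := hδ
  have hcross : (γ 0 : ℝ) * (n • l.1) 1 - γ 1 * (n • l.1) 0 = n * (rayCross l γ : ℝ) := by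
    simp only [rayCross_apply, Finsupp.smul_apply, smul_eq_mul]
    push_cast
    ring
  rw [hcross, mul_nonneg_iff_of_pos_left (Nat.cast_pos.2 hn), Int.cast_nonneg_iff]

/-! ### Abelian invariants as Harder–Narasimhan factors -/

theorem card_stdVertex {V : Type} (m : V →₀ ℕ) : Fintype.card (StdVertex m) = m.degree := by
  rw [Fintype.card_sigma]
  simp only [Fintype.card_fin]
  exact Finset.sum_coe_sort m.support fun i => m i

theorem card_qArrow_stdVertex {V : Type} (r : V → V → ℕ) (m : V →₀ ℕ) :
    Fintype.card (QArrow fun x y : StdVertex m => r x.1 y.1) = quiverForm r m m := by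
  have h := quiverForm_dimVec r (fun x : StdVertex m => (x.1 : V)) Finset.univ Finset.univ
  rw [dimVec_stdVertex, Finset.univ_product_univ] at h
  simp only [h, Fintype.card_sigma, Fintype.card_fin]

/-- The unit `q^{1/2} - q^{-1/2}` of `𝒱`. -/
noncomputable def gmUnit : MotVˣ :=
  Units.map (algebraMap HalfField MotV).toMonoidHom (Units.mk0 gmVir gmVir_ne_zero)

theorem hnUnit_sqrtQ_gmUnit {V : Type} (r : V → V → ℕ) (m : V →₀ ℕ) :
    (hnUnit r sqrtQ gmUnit m : MotV) = algebraMap HalfField MotV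
      (HalfField.t ^ ((m.degree : ℤ) - quiverForm r m m) *
        ((HalfField.t ^ 2 - 1) ^ m.degree)⁻¹) := by
  have hq : HalfField.t ^ 2 - 1 = gmVir * HalfField.t := by
    rw [gmVir, sub_mul, inv_mul_cancel₀ HalfField.t_ne_zero, pow_two]
  have hprefactor : HalfField.t ^ ((m.degree : ℤ) - quiverForm r m m) *
      ((HalfField.t ^ 2 - 1) ^ m.degree)⁻¹ =
      gmVir ^ (-(m.degree : ℤ)) * HalfField.t ^ (-(quiverForm r m m : ℤ)) := by
    rw [hq, mul_pow, sub_eq_add_neg, zpow_add₀ HalfField.t_ne_zero, zpow_neg gmVir, zpow_natCast,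
      zpow_natCast, mul_inv]
    field_simp [HalfField.t_ne_zero]
  rw [hprefactor, hnUnit, gmUnit, sqrtQ, ← map_zpow, ← map_zpow, ← map_mul, Units.coe_map,
    Units.val_mul, Units.val_zpow_eq_zpow_val, Units.val_zpow_eq_zpow_val]
  rfl

theorem algebraMap_relationSum_stdVertex {V : Type} (r : V → V → ℕ) (D : (V →₀ ℕ) → Prop)
    (m : V →₀ ℕ) :
    algebraMap HalfField MotV
      (relationSum (fun p : StdVertex m × StdVertex m => (HalfField.t ^ 2) ^ r p.1.1 p.2.1 - 1)
        (fun T => D (dimVec (fun x : StdVertex m => (x.1 : V)) T)) Finset.univ) =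
      dimSum (arrowWeight r sqrtQ) D m := by
  simp only [dimSum, relationSum, map_sum, map_prod, map_sub, map_pow, map_one]
  rfl

theorem inv_multiFactorial_smul_fDim {V : Type} (r : V → V → ℕ) (Z : (V →₀ ℕ) →+ ℂ)
    (m : V →₀ ℕ) :
    (multiFactorial m : ℚ)⁻¹ • fDim r (fun i => Z (Finsupp.single i 1)) m =
      hnCoeff r sqrtQ gmUnit (fun m' => zslope (Z m') ≤ zslope (Z m)) m := by
  have hZ (X : Finset (StdVertex m)) : ∑ x ∈ X, Z (Finsupp.single (x.1 : V) 1) =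
      Z (dimVec (fun x : StdVertex m => (x.1 : V)) X) := (map_dimVec Z _ X).symm
  rw [hnCoeff, fDim, fAbelian_eq, map_mul, card_stdVertex, card_qArrow_stdVertex,
    ← hnUnit_sqrtQ_gmUnit, ← algebraMap_relationSum_stdVertex]
  simp only [hZ, dimVec_stdVertex]

section HatQuiver

variable {ω : GPlus →+ GPlus →+ ℤ}

theorem quiverSkew_hatQuiver (hω : ∀ γ δ, ω δ γ = -ω γ δ) (m m' : GStar →₀ ℕ) :
    quiverSkew (hatQuiver ω) m m' = ω (mnormHom m) (mnormHom m') := by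
  have hcomp : quiverSkew (hatQuiver ω) =
      ((AddMonoidHom.compHom (M := GStar →₀ ℕ) (N := GPlus) (P := ℤ)).flip mnormHom).comp
        (ω.comp mnormHom) := by
    refine Finsupp.addHom_ext' fun α => AddMonoidHom.ext_nat ?_
    refine Finsupp.addHom_ext' fun β => AddMonoidHom.ext_nat ?_
    change (quiverForm (hatQuiver ω) (Finsupp.single β 1) (Finsupp.single α 1) : ℤ) -
      quiverForm (hatQuiver ω) (Finsupp.single α 1) (Finsupp.single β 1) =
        ω (mnorm (Finsupp.single α 1)) (mnorm (Finsupp.single β 1))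
    rw [quiverForm_single, quiverForm_single, mnorm_single, mnorm_single, one_smul, one_smul,
      hatQuiver, hatQuiver, hω α.1 β.1]
    omega
  rw [hcomp]
  rfl

theorem mnorm_eq_zero {m : GStar →₀ ℕ} : mnorm m = 0 ↔ m = 0 :=
  ⟨QTorus.eq_zero_of_finite_ker (finite_mnormHom_eq 0), fun h => h ▸ mnorm_zero⟩

open Classical in
theorem hnFactor_eq_one_add {Z : GPlus →+ ℂ} (hZ : ∀ i, HPlus (Z (Finsupp.single i 1)))
    (hlt : zslope (Z (Finsupp.single 0 1)) < zslope (Z (Finsupp.single 1 1))) (l : Ray) :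
    hnFactor (hatQuiver ω) sqrtQ gmUnit ((rayCross l).comp mnormHom) =
      1 + ⟨fun m => if l.Mem (mnorm m) then
        (mfact m : ℚ)⁻¹ • fDim (hatQuiver ω) (fun α => Z α.1) m else 0⟩ := by
  ext m
  rw [QTorus.coeff_add, QTorus.coeff_one]
  rcases eq_or_ne m 0 with rfl | hm
  · have hmem : ¬ l.Mem (mnorm 0) := fun h => h.ne_zero mnorm_zero
    simp only [hnFactor, map_zero, if_true, hnCoeff_zero, if_neg hmem, add_zero]
  · have hm' : mnorm m ≠ 0 := mnorm_eq_zero.not.2 hm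
    simp only [hnFactor, AddMonoidHom.comp_apply, mnormHom_apply, rayCross_eq_zero_iff hm',
      if_neg hm, zero_add]
    split_ifs with hl
    · have hfDim := inv_multiFactorial_smul_fDim (hatQuiver ω) (Z.comp mnormHom) m
      simp only [AddMonoidHom.comp_apply, mnormHom_apply, mnorm_single, one_smul] at hfDim
      refine Eq.trans (hnCoeff_congr _ _ _ fun m' _ hm' => ?_) hfDim.symm
      exact (zslope_map_le_iff hZ hlt (mnorm_eq_zero.not.2 hm') hl).symm
    · rfl

end HatQuiver

/-! ### Stabilities destabilised by the arrows -/

section Destabilized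

variable {V : Type}

theorem dimSum_eq_one {R : Type*} [CommSemiring R] {w : V → V → R} {D : (V →₀ ℕ) → Prop}
    {m : V →₀ ℕ} (hw : ∀ i ∈ m.support, ∀ j ∈ m.support, w i j = 0) (hD : ∀ m' ≤ m, D m') :
    dimSum w D m = 1 := by
  classical
  rw [dimSum, relationSum, Finset.sum_eq_single ∅, Finset.prod_empty]
  · intro E _ hE
    obtain ⟨p, hp⟩ := Finset.nonempty_iff_ne_empty.2 hE
    exact Finset.prod_eq_zero hp (hw _ p.1.1.2 _ p.2.1.2)
  · refine fun h => (h (Finset.mem_filter.2 ⟨Finset.empty_mem_powerset _, fun T hT _ _ => ?_⟩)).elim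
    exact hD _ ((dimVec_mono _ hT).trans_eq (dimVec_stdVertex m))

theorem dimVec_filter {W : Type*} (P : V → Prop) [DecidablePred P] (lab : W → V) (X : Finset W) :
    dimVec lab {x ∈ X | P (lab x)} = (dimVec lab X).filter P := by
  change _ = Finsupp.filterAddHom P (dimVec lab X)
  rw [map_dimVec, dimVec, Finset.sum_filter]
  refine Finset.sum_congr rfl fun x _ => ?_
  split_ifs with hx
  exacts [(Finsupp.filter_single_of_pos P hx).symm, (Finsupp.filter_single_of_neg P hx).symm]

theorem dimSum_eq_zero {R : Type*} [CommSemiring R] {w : V → V → R} {D : (V →₀ ℕ) → Prop}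
    {m : V →₀ ℕ} (P : V → Prop) [DecidablePred P] (hw : ∀ i j, w i j ≠ 0 → P i → P j)
    (hm : m.filter P ≠ 0) (hD : ¬ D (m.filter P)) : dimSum w D m = 0 := by
  have hT : dimVec (fun x : StdVertex m => (x.1 : V)) {x | P x.1} = m.filter P := by
    rw [dimVec_filter, dimVec_stdVertex]
  rw [← hT] at hm hD
  classical
  refine Finset.sum_eq_zero fun E hE => ?_
  by_contra hne
  have hclosed : IsClosedUnder E {x : StdVertex m | P x.1} := fun p hp hp1 =>
    Finset.mem_filter.2 ⟨Finset.mem_univ _,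
      hw _ _ (fun h => hne (Finset.prod_eq_zero hp h)) (Finset.mem_filter.1 hp1).2⟩
  exact hD ((Finset.mem_filter.1 hE).2 _ (Finset.subset_univ _)
    (Finset.nonempty_iff_ne_empty.2 (dimVec_eq_zero.not.1 hm)) hclosed)

theorem map_eq_sum_smul {G : Type*} [AddCommMonoid G] (θ : (V →₀ ℕ) →+ G) (m : V →₀ ℕ) :
    θ m = ∑ i ∈ m.support, m i • θ (Finsupp.single i 1) := by
  conv_lhs => rw [← m.sum_single, Finsupp.sum, map_sum]
  refine Finset.sum_congr rfl fun i _ => ?_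
  rw [← map_nsmul, Finsupp.smul_single_one]

theorem quiverForm_eq_zero {r : V → V → ℕ} {m m' : V →₀ ℕ}
    (h : ∀ i ∈ m.support, ∀ j ∈ m'.support, r i j = 0) : quiverForm r m m' = 0 :=
  Finset.sum_eq_zero fun i hi => Finset.sum_eq_zero fun j hj =>
    mul_eq_zero_of_right _ (h i hi j hj)

variable {G : Type*} [AddCommMonoid G] [LinearOrder G] [IsOrderedCancelAddMonoid G]
  {θ : (V →₀ ℕ) →+ G}

theorem map_neg_of_forall_neg {m : V →₀ ℕ} (hm : m ≠ 0)
    (h : ∀ i ∈ m.support, θ (Finsupp.single i 1) < 0) : θ m < 0 := by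
  rw [map_eq_sum_smul]
  exact Finset.sum_neg (fun i hi => nsmul_neg (h i hi) (Finsupp.mem_support_iff.1 hi))
    (Finsupp.support_nonempty_iff.2 hm)

theorem exists_mem_support_neg {m : V →₀ ℕ} (hm : θ m = 0)
    (h : ¬ ∀ i ∈ m.support, θ (Finsupp.single i 1) = 0) :
    ∃ i ∈ m.support, θ (Finsupp.single i 1) < 0 := by
  by_contra! hnonneg
  refine h fun i hi => ?_
  rw [map_eq_sum_smul, Finset.sum_eq_zero_iff_of_nonneg fun i hi => nsmul_nonneg (hnonneg i hi) _]
    at hm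
  exact (nsmul_eq_zero_iff_right (Finsupp.mem_support_iff.1 hi)).1 (hm i hi)

variable {r : V → V → ℕ} {R : Type*} [CommRing R]

open Classical in
theorem dimSum_arrowWeight_nonneg (v : Rˣ)
    (hzero : ∀ i j, θ (Finsupp.single i 1) = 0 → θ (Finsupp.single j 1) = 0 → r i j = 0)
    (hneg : ∀ i j, r i j ≠ 0 → θ (Finsupp.single i 1) < 0 → θ (Finsupp.single j 1) < 0)
    {m : V →₀ ℕ} (hm : θ m = 0) :
    dimSum (arrowWeight r v) (fun m' => 0 ≤ θ m') m =
      if ∀ i ∈ m.support, θ (Finsupp.single i 1) = 0 then 1 else 0 := by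
  have hweight (i j) (h : r i j = 0) : arrowWeight r v i j = 0 := by
    rw [arrowWeight, h, pow_zero, sub_self]
  split_ifs with h
  · refine dimSum_eq_one (fun i hi j hj => hweight i j (hzero i j (h i hi) (h j hj)))
      fun m' hm' => ?_
    rw [map_eq_sum_smul]
    exact Finset.sum_nonneg fun i hi =>
      nsmul_nonneg (h i (Finsupp.support_mono hm' hi)).ge _
  · obtain ⟨i, hi, hi'⟩ := exists_mem_support_neg hm h
    have hne : m.filter (fun i => θ (Finsupp.single i 1) < 0) ≠ 0 := fun h0 =>
      Finsupp.mem_support_iff.1 hi ((Finsupp.filter_eq_zero_iff _ _).1 h0 i hi')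
    refine dimSum_eq_zero _ (fun i j hij => hneg i j fun h => hij (hweight i j h)) hne ?_
    refine (map_neg_of_forall_neg hne fun j hj => ?_).not_ge
    rw [Finsupp.support_filter] at hj
    exact (Finset.mem_filter.1 hj).2

theorem hnFactor_eq_exp_vertexSum [DecidableEq V] [Algebra ℚ R] (v u : Rˣ)
    (hzero : ∀ i j, θ (Finsupp.single i 1) = 0 → θ (Finsupp.single j 1) = 0 → r i j = 0)
    (hneg : ∀ i j, r i j ≠ 0 → θ (Finsupp.single i 1) < 0 → θ (Finsupp.single j 1) < 0) :
    hnFactor r v u θ = QTorus.exp (QTorus.vertexSum v (quiverSkew r)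
      (fun i => θ (Finsupp.single i 1) = 0) ((u⁻¹ : Rˣ) : R)) := by
  classical
  have hform {m m' : V →₀ ℕ} (h : ∀ i ∈ m.support, θ (Finsupp.single i 1) = 0)
      (h' : ∀ i ∈ m'.support, θ (Finsupp.single i 1) = 0) : quiverForm r m m' = 0 :=
    quiverForm_eq_zero fun i hi j hj => hzero i j (h i hi) (h' j hj)
  ext m
  rw [hnFactor, QTorus.coeff_exp_vertexSum]
  · have hθ (h : ∀ i ∈ m.support, θ (Finsupp.single i 1) = 0) : θ m = 0 := by
      rw [map_eq_sum_smul]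
      exact Finset.sum_eq_zero fun i hi => by rw [h i hi, smul_zero]
    by_cases hm : θ m = 0
    · simp only [hm, if_true]
      rw [hnCoeff, dimSum_arrowWeight_nonneg v hzero hneg hm]
      split_ifs with h
      · simp [hnUnit, hform h h]
      · rw [mul_zero, smul_zero]
    · simp only [hm, if_false, mt hθ hm]
  · intro i m hi hm
    have hi' : ∀ j ∈ (Finsupp.single i 1 : V →₀ ℕ).support, θ (Finsupp.single j 1) = 0 :=
      fun j hj => by rwa [Finset.mem_singleton.1 (Finsupp.support_single_subset hj)]
    change (quiverForm r m (Finsupp.single i 1) : ℤ) - quiverForm r (Finsupp.single i 1) m = 0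
    rw [hform hm hi', hform hi' hm, sub_self]

end Destabilized

/-! ### The wall-crossing formula -/

/-- The form `ω` is a nonnegative multiple of the determinant; then every arrow of the quiver `Q̂`
strictly decreases the slope. -/
def IsNonnegMulDet (ω : GPlus →+ GPlus →+ ℤ) : Prop :=
  ∃ κ : ℤ, 0 ≤ κ ∧ ∀ γ δ : GPlus, ω γ δ = κ * ((γ 0 : ℤ) * δ 1 - γ 1 * δ 0)

theorem isNonnegMulDet_formPlus {Γ : Type*} [AddCommGroup Γ] (e : Module.Basis (Fin 2) ℤ Γ)
    {ω : LinearMap.BilinForm ℤ Γ} (hω : ω.IsAlt) (hnonneg : 0 ≤ ω (e 0) (e 1)) :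
    IsNonnegMulDet (formPlus e ω) := by
  refine ⟨ω (e 0) (e 1), hnonneg, fun γ δ => ?_⟩
  change ω (γ 0 • e 0 + γ 1 • e 1) (δ 0 • e 0 + δ 1 • e 1) = _
  simp only [map_add, LinearMap.add_apply, map_nsmul, LinearMap.smul_apply, hω.self_eq_zero,
    ← hω.neg_eq (e 0) (e 1), nsmul_eq_mul, smul_neg, smul_zero]
  ring

section WallCrossing

variable {ω : GPlus →+ GPlus →+ ℤ}

theorem IsNonnegMulDet.antisymm (hω : IsNonnegMulDet ω) (γ δ : GPlus) : ω δ γ = -ω γ δ := by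
  obtain ⟨κ, -, h⟩ := hω
  rw [h, h]
  ring

theorem hatQuiver_eq_zero_of_mem (hω : IsNonnegMulDet ω) {l : Ray} {α β : GStar}
    (hα : l.Mem α.1) (hβ : l.Mem β.1) : hatQuiver ω α β = 0 := by
  obtain ⟨κ, -, h⟩ := hω
  obtain ⟨n, -, hn⟩ := hα
  obtain ⟨n', -, hn'⟩ := hβ
  have hzero : ω β.1 α.1 = 0 := by
    simp only [h, hn, hn', Finsupp.smul_apply, smul_eq_mul, Nat.cast_mul]
    ring
  rw [hatQuiver, hzero, Int.toNat_zero]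

theorem rayCross_pos_of_hatQuiver_ne_zero (hω : IsNonnegMulDet ω) {l : Ray} {α β : GStar}
    (h : hatQuiver ω α β ≠ 0) (hα : 0 < rayCross l α.1) : 0 < rayCross l β.1 := by
  obtain ⟨κ, hκ, hω⟩ := hω
  rw [hatQuiver, hω, Ne, Int.toNat_eq_zero, not_le] at h
  have hdet : 0 < (β.1 0 : ℤ) * α.1 1 - β.1 1 * α.1 0 := pos_of_mul_pos_right h hκ
  rw [rayCross_apply] at hα ⊢
  have hβ0 : (0 : ℤ) < β.1 0 := by
    refine (Int.natCast_nonneg _).lt_of_ne fun h0 => hdet.not_ge ?_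
    rw [← h0, zero_mul, zero_sub]
    exact neg_nonpos.2 (by positivity)
  refine pos_of_mul_pos_left (b := (α.1 0 : ℤ)) ?_ (Int.natCast_nonneg _)
  calc (0 : ℤ) < β.1 0 * (α.1 0 * l.1 1 - α.1 1 * l.1 0) +
        l.1 0 * (β.1 0 * α.1 1 - β.1 1 * α.1 0) := by positivity
    _ = _ := by ring

theorem hnFactor_neg_rayCross (hω : IsNonnegMulDet ω) {R : Type*} [CommRing R] [Algebra ℚ R]
    (v u : Rˣ) (l : Ray) : hnFactor (hatQuiver ω) v u ((-rayCross l).comp mnormHom) =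
      QTorus.exp (QTorus.vertexSum v _ (fun α => l.Mem α.1) ((u⁻¹ : Rˣ) : R)) := by
  have hθ (α : GStar) : (-rayCross l).comp mnormHom (Finsupp.single α 1) = -rayCross l α.1 := by
    rw [AddMonoidHom.comp_apply, mnormHom_apply, mnorm_single, one_smul, AddMonoidHom.neg_apply]
  have hmem (α : GStar) : (-rayCross l).comp mnormHom (Finsupp.single α 1) = 0 ↔ l.Mem α.1 := by
    rw [hθ, neg_eq_zero, rayCross_eq_zero_iff α.2]
  rw [hnFactor_eq_exp_vertexSum]
  · simp only [hmem]
  · simp only [hmem]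
    exact fun _ _ => hatQuiver_eq_zero_of_mem hω
  · simp only [hθ, neg_lt_zero]
    exact fun _ _ => rayCross_pos_of_hatQuiver_ne_zero hω

/-- The homomorphism from the quantum torus of `Q̂` to that of `Γ` which maps `x^m` to
`∏ a_α^{m(α)} x^{‖m‖}`. -/
noncomputable def mnormSubstitution (hω : IsNonnegMulDet ω) (a : GStar → MotV) :
    QTorus sqrtQ (quiverSkew (hatQuiver ω)) →+* QTorus sqrtQ ω :=
  QTorus.substitution finite_mnormHom_eq (quiverSkew_hatQuiver hω.antisymm) a

/-- The generating series of all abelian representations of `Q̂`. -/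
noncomputable def totalSeries (ω : GPlus →+ GPlus →+ ℤ) :
    QTorus sqrtQ (quiverSkew (hatQuiver ω)) :=
  ⟨hnCoeff (hatQuiver ω) sqrtQ gmUnit fun _ => True⟩

theorem hasOrderedProd_mnormSubstitution (hω : IsNonnegMulDet ω) (a : GStar → MotV)
    {before : Ray → Ray → Prop} (θ : Ray → GPlus →+ ℤ)
    (hθ : ∀ l l', before l l' → ∀ γ, γ ≠ 0 → 0 ≤ θ l' γ → 0 < θ l γ)
    (hzero : ∀ l γ, l.Mem γ → θ l γ = 0) :
    HasOrderedProd before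
      (fun l => mnormSubstitution hω a
        (hnFactor (hatQuiver ω) sqrtQ gmUnit ((θ l).comp mnormHom)))
      (mnormSubstitution hω a (totalSeries ω)) := by
  classical
  choose ray hray using fun α : GStar => exists_ray α.2
  intro γ
  have hS : {α : GStar | α.1 ≤ γ}.Finite :=
    (Set.finite_Iic γ).preimage Subtype.val_injective.injOn
  refine ⟨hS.toFinset.image ray, fun L hL hSL => ?_⟩
  have hmap : (L.map fun l => mnormSubstitution hω a
        (hnFactor (hatQuiver ω) sqrtQ gmUnit ((θ l).comp mnormHom))).prod =
      mnormSubstitution hω a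
        (L.map fun l => hnFactor (hatQuiver ω) sqrtQ gmUnit ((θ l).comp mnormHom)).prod := by
    rw [map_list_prod, List.map_map]
    rfl
  rw [hmap, mnormSubstitution, QTorus.coeff_substitution, QTorus.coeff_substitution]
  refine Finset.sum_congr rfl fun m hm => ?_
  rw [Set.Finite.mem_toFinset] at hm
  obtain rfl : mnorm m = γ := hm
  rw [coeff_prod_hnFactor_eq_total]
  · rfl
  · exact hL.imp fun {l l'} h m' _ h0 => hθ l l' h _ (mnorm_eq_zero.not.2 h0)
  · intro m' hm' h0
    let α : GStar := ⟨mnorm m', mnorm_eq_zero.not.2 h0⟩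
    have hα : α.1 ≤ mnorm m := by
      obtain ⟨m'', rfl⟩ := exists_add_of_le hm'
      exact mnorm_add m' m'' ▸ le_self_add
    exact ⟨ray α, hSL _ (Finset.mem_image_of_mem _ (hS.mem_toFinset.2 hα)),
      hzero _ _ (hray α)⟩

theorem mnormSubstitution_vertexSum (hω : IsNonnegMulDet ω) (a : GStar → MotV) (l : Ray) :
    mnormSubstitution hω a
      (QTorus.vertexSum sqrtQ _ (fun α => l.Mem α.1) ((gmUnit⁻¹ : MotVˣ) : MotV)) =
      rayLog ω a l := by
  classical
  ext γ
  rcases eq_or_ne γ 0 with rfl | hγ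
  · rw [mnormSubstitution, QTorus.coeff_substitution_zero, QTorus.coeff_vertexSum_zero,
      coeff_rayLog_zero]
  lift γ to GStar using hγ
  have hmem (α : GStar) : Finsupp.single α 1 ∈ (finite_mnormHom_eq γ.1).toFinset ↔ α = γ := by
    rw [Set.Finite.mem_toFinset, Set.mem_ofPred_eq, mnormHom_apply, mnorm_single, one_smul,
      Subtype.ext_iff]
  rw [mnormSubstitution, QTorus.coeff_substitution, coeff_rayLog,
    Finset.sum_eq_single (Finsupp.single γ 1)]
  · rw [QTorus.coeff_vertexSum_single, Finsupp.prod_single_index (h := fun α k => a α ^ k)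
      (pow_zero _), pow_one, ite_mul, zero_mul, Algebra.smul_def]
    rfl
  · intro m hm hne
    rw [QTorus.coeff_vertexSum_eq_zero, zero_mul]
    rintro α rfl
    exact hne (by rw [(hmem α).1 hm])
  · exact fun h => (h ((hmem γ).2 rfl)).elim

theorem hasOrderedProd_rayExp (hω : IsNonnegMulDet ω) (a : GStar → MotV) :
    HasOrderedProd (fun l l' => l.slopeLT l') (rayExp ω a)
      (mnormSubstitution hω a (totalSeries ω)) := by
  have hprod := hasOrderedProd_mnormSubstitution hω a (before := fun l l' => l.slopeLT l')
    (fun l => -rayCross l)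
    (fun l l' h γ hγ h' => neg_pos.2 (rayCross_neg_of_slopeLT h hγ (neg_nonneg.1 h')))
    (fun l γ hγ => neg_eq_zero.2 hγ.rayCross_eq_zero)
  convert hprod using 2 with l
  rw [hnFactor_neg_rayCross hω, ← exp_rayLog, ← mnormSubstitution_vertexSum hω, mnormSubstitution,
    QTorus.substitution_exp _ _ _ (QTorus.coeff_vertexSum_zero _ _)]

/-- The right hand side of the Manschot–Pioline–Sen formula. -/
noncomputable def mpsSum (g : (GStar →₀ ℕ) → MotV) (a : GStar → MotV) (γ : GStar) : MotV :=
  ∑ m ∈ (finite_mnormHom_eq γ.1).toFinset,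
    (mfact m : ℚ)⁻¹ • (g m * m.prod fun α k => a α ^ k)

theorem mpsFormula_iff (g : (GStar →₀ ℕ) → MotV) (b a : GStar → MotV) :
    MPSFormula g b a ↔ b = mpsSum g a := by
  rw [MPSFormula, funext_iff]
  exact forall_congr' fun γ =>
    Eq.congr_right (finsum_mem_eq_finite_toFinset_sum _ (finite_mnormHom_eq γ.1))

open Classical in
theorem mnormSubstitution_invariants (hω : IsNonnegMulDet ω) (g : (GStar →₀ ℕ) → MotV)
    (a : GStar → MotV) (l : Ray) :
    mnormSubstitution hω a
      ⟨fun m => if l.Mem (mnorm m) then (mfact m : ℚ)⁻¹ • (gmVir⁻¹ • g m) else 0⟩ =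
      rayLog ω (mpsSum g a) l := by
  ext γ
  rcases eq_or_ne γ 0 with rfl | hγ
  · rw [mnormSubstitution, QTorus.coeff_substitution_zero, coeff_rayLog_zero]
    exact if_neg fun h => h.ne_zero mnorm_zero
  lift γ to GStar using hγ
  rw [mnormSubstitution, QTorus.coeff_substitution, coeff_rayLog, mpsSum, Finset.smul_sum]
  have hnorm : ∀ m ∈ (finite_mnormHom_eq γ.1).toFinset, mnorm m = γ := fun m hm => by
    rwa [Set.Finite.mem_toFinset] at hm
  split_ifs with hl
  · refine Finset.sum_congr rfl fun m hm => ?_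
    dsimp only
    rw [hnorm m hm, if_pos hl, smul_mul_assoc, smul_mul_assoc, smul_comm]
  · refine Finset.sum_eq_zero fun m hm => ?_
    dsimp only
    rw [hnorm m hm, if_neg hl, zero_mul]

theorem hasOrderedProd_rayExp_mpsSum (hω : IsNonnegMulDet ω) {Z : GPlus →+ ℂ}
    (hZ : ∀ i, HPlus (Z (Finsupp.single i 1)))
    (hlt : zslope (Z (Finsupp.single 0 1)) < zslope (Z (Finsupp.single 1 1)))
    {g : (GStar →₀ ℕ) → MotV} (hg : IsAbelianInvariants ω Z g) (a : GStar → MotV) :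
    HasOrderedProd (fun l l' => l'.slopeLT l) (rayExp ω (mpsSum g a))
      (mnormSubstitution hω a (totalSeries ω)) := by
  have hprod := hasOrderedProd_mnormSubstitution hω a (before := fun l l' => l'.slopeLT l)
    rayCross (fun l l' h γ hγ h' => rayCross_pos_of_slopeLT h hγ h')
    (fun l γ hγ => hγ.rayCross_eq_zero)
  convert hprod using 2 with l
  rw [hnFactor_eq_one_add hZ hlt, hg l, ← exp_rayLog, ← mnormSubstitution_invariants hω,
    mnormSubstitution, QTorus.substitution_exp]
  exact if_neg fun h => h.ne_zero mnorm_zero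

end WallCrossing

theorem mainTheorem1 {Γ : Type*} [AddCommGroup Γ] (e : Module.Basis (Fin 2) ℤ Γ)
    (ω : LinearMap.BilinForm ℤ Γ) (hω : ω.IsAlt) (hpos : 0 < ω (e 0) (e 1))
    (Z : Γ →+ ℂ) (hZ : ∀ i, HPlus (Z (e i))) (hchamber : zslope (Z (e 0)) < zslope (Z (e 1)))
    (g : (GStar →₀ ℕ) → MotV)
    (hg : IsAbelianInvariants (formPlus e ω) (Z.comp (toLattice e)) g)
    (b a : GStar → MotV) :
    KSFormula (formPlus e ω) b a ↔ MPSFormula g b a := by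
  have hdet : IsNonnegMulDet (formPlus e ω) := isNonnegMulDet_formPlus e hω hpos.le
  have hsingle (i : Fin 2) : Z.comp (toLattice e) (Finsupp.single i 1) = Z (e i) := by
    fin_cases i <;> simp [toLattice]
  simp only [← hsingle] at hZ hchamber
  have ha := hasOrderedProd_rayExp hdet a
  have hmps := hasOrderedProd_rayExp_mpsSum hdet hZ hchamber hg a
  rw [mpsFormula_iff]
  constructor
  · rintro ⟨P, hb, ha'⟩
    obtain rfl := ha'.unique ha
    exact rayExp_factorization_unique hb hmps
  · rintro rfl
    exact ⟨_, hmps, ha⟩
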